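/- Fix the language with $0,s,\hat a$ (addition), $\hat m$ (multiplication) and the single predicate symbol $=$, over one numeric sort. Its free variables are *parameters* of three kinds, countably many of each: *active*, *passive* and *internal*. $V_a(S),V_p(S),V_i(S)$ are the active, passive and internal parameters occurring in $S$. Sequents $\Gamma\vdash\Delta$ are pairs of finite multisets of formulas (built with $\neg,\wedge,\vee,\to,\forall,\exists$), and every sequent in a derivation contains at most one active parameter. **Calculi.** $mv\mathbf{LKE}$ is the classical sequent calculus $\mathbf{LK}$ with cut in which eigenvariables are passive parameters and a term may be quantified (in $\forall{:}l$, $\exists{:}r$) only if it contains no active or internal parameter. Its initial sequents are $A\vdash A$, the equality axioms ($\vdash t=t$ and congruence for $s,\hat a,\hat m,=$), $s(t)=0\vdash$, $\;s(t)=s(u)\vdash t=u$, and the recursion equations $\hat a(0,t)=t$, $\hat a(s(u),t)=s(\hat a(u,t))$, $\hat m(0,t)=0$, $\hat m(s(u),t)=\hat a(\hat m(u,t),t)$. It also has the rule $\mathcal E$, which replaces terms in a sequent by terms equal to them modulo these recursion equations. $mv\mathbf{LKIE}$ is $mv\mathbf{LKE}$ plus the rule $$\frac{F(n,\mathbf m_1,\dots,\mathbf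 m_k),\Gamma\vdash\Delta,F(s(n),\mathbf m_1,\dots,\mathbf m_k)}{F(0,\mathbf a_1,\dots,\mathbf a_k),\Gamma\vdash\Delta,F(t,\mathbf a_1,\dots,\mathbf a_k)}$$ where the active parameter $n$ and the internal parameters $\mathbf m_i$ do not occur in $\Gamma,\Delta$, and $t,\mathbf a_i$ are arbitrary terms. $mv\mathbf{LKS}$ is $mv\mathbf{LKE}$ in which leaves may also be *links*: a proof symbol with arguments (terms) placed over a sequent. **Components.** For an active parameter $n$ and a set $\mathcal I$ of internal parameters, an $(n,\mathcal I)$-component with end-sequent $S$, where $V_a(S)\subseteq\{n\}$ and $V_i(S)=\mathcal I$, is a triple $(\psi,\pi,\nu)$ of a proof symbol $\psi$, an $mv\mathbf{LKS}$-derivation $\pi$ of $S\{n\leftarrow 0\}$ without active parameters, and an $mv\mathbf{LKS}$-derivation $\nu$ of $S\{n\leftarrow s(n)\}$ with no active parameter other than $n$. For distinct components write $C\prec D$ if every sequent $T$ in $C$ associated with a link to $D$ satisfies $V_p(S_D)\subseteq V_p(T)$, where $S_D$ is the end-sequent of $D$. **$\mathbf P$-schemata.** Let $\mathbf P$ be a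 set of passive parameters. A $\mathbf P$-schema is a finite non-empty sequence $\langle C_1,\dots,C_\alpha\rangle$ of components with pairwise distinct proof symbols and with all passive parameters in $\mathbf P$, together with a well-founded transitive relation $\prec^*\subseteq\prec$ on them with $C_1$ as least element. Every link in $C_i$ must be to some $C_j$ of the sequence, its sequent must be the instance of the end-sequent of $C_j$ given by the arguments of the link, and either $C_i\prec^* C_j$, or $j=i$, the link is in the step case $\nu$ of $C_i$, and its argument for the active parameter $n$ of $C_i$ is $n$ itself. The end-sequent of the $\mathbf P$-schema is that of $C_1$. (No strictness or completeness is required, so computational sub-$\mathbf P$-schemata are allowed.) **Theorem.** For every sequent $S$: there are a set $\mathbf P$ of passive parameters and a $\mathbf P$-schema with end-sequent $S$ if and only if there is an $mv\mathbf{LKIE}$-derivation of $S$. -/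

import Mathlib

namespace PSchemata

/-! ### Syntax: schematic terms, formulas and sequents -/

/-- The three kinds of parameters of the numeric sort; there are countably many of each kind. -/
inductive Param : Type
  | active : ℕ → Param
  | passive : ℕ → Param
  | internal : ℕ → Param

/-- Schematic terms in the scope of `k` quantifiers (de Bruijn indices, `0` is the innermost
quantifier).  `Term 0` is the set of schematic terms; `add` and `mul` are the two defined function
symbols. -/
inductive Term (k : ℕ) : Type
  | bvar : Fin k → Term k
  | param : Param → Term k
  | zero : Term k
  | succ : Term k → Term k
  | add : Term k → Term k → Term k
  | mul : Term k → Term k → Term k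

/-- Formulas in the scope of `k` quantifiers; equality is the only predicate symbol. -/
inductive Formula : ℕ → Type
  | eq {k : ℕ} : Term k → Term k → Formula k
  | neg {k : ℕ} : Formula k → Formula k
  | and {k : ℕ} : Formula k → Formula k → Formula k
  | or {k : ℕ} : Formula k → Formula k → Formula k
  | imp {k : ℕ} : Formula k → Formula k → Formula k
  | all {k : ℕ} : Formula (k + 1) → Formula k
  | ex {k : ℕ} : Formula (k + 1) → Formula k

/-- A schematic sequent `ante ⊢ succ`: a pair of multisets of formulas. -/
structure Sequent : Type where
  ante : Multiset (Formula 0)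
  succ : Multiset (Formula 0)

/-! ### Occurrences of parameters -/

/-- The parameters occurring in a term. -/
def Term.params {k : ℕ} : Term k → Set Param
  | .bvar _ => ∅
  | .param p => {p}
  | .zero => ∅
  | .succ t => t.params
  | .add s t => s.params ∪ t.params
  | .mul s t => s.params ∪ t.params

/-- The parameters occurring in a formula. -/
def Formula.params : {k : ℕ} → Formula k → Set Param
  | _, .eq s t => s.params ∪ t.params
  | _, .neg A => A.params
  | _, .and A B => A.params ∪ B.params
  | _, .or A B => A.params ∪ B.params
  | _, .imp A B => A.params ∪ B.params
  | _, .all A => A.params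
  | _, .ex A => A.params

/-- The parameters occurring in a sequent. -/
def Sequent.params (S : Sequent) : Set Param :=
  {p | (∃ A ∈ S.ante, p ∈ A.params) ∨ ∃ A ∈ S.succ, p ∈ A.params}

/-- The set `V_a(S)`. -/
def Sequent.actives (S : Sequent) : Set ℕ := {n | Param.active n ∈ S.params}

/-- The set `V_p(S)`. -/
def Sequent.passives (S : Sequent) : Set ℕ := {n | Param.passive n ∈ S.params}

/-- The set `V_i(S)`. -/
def Sequent.internals (S : Sequent) : Set ℕ := {n | Param.internal n ∈ S.params}

/-- Sequents with more than one active parameter are not considered. -/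
def Sequent.AtMostOneActive (S : Sequent) : Prop := S.actives.Subsingleton

/-! ### Substitution -/

/-- Weakening of a term to the scope of one more quantifier. -/
def Term.weaken {k : ℕ} : Term k → Term (k + 1)
  | .bvar i => .bvar i.succ
  | .param p => .param p
  | .zero => .zero
  | .succ t => .succ t.weaken
  | .add s t => .add s.weaken t.weaken
  | .mul s t => .mul s.weaken t.weaken

/-- A simultaneous substitution of terms for bound variables and for parameters. -/
structure Subst (k m : ℕ) : Type where
  bvar : Fin k → Term m
  param : Param → Term m

/-- The substitution under a quantifier: the newly bound variable is kept. -/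
def Subst.lift {k m : ℕ} (σ : Subst k m) : Subst (k + 1) (m + 1) where
  bvar := Fin.cases (.bvar 0) (fun i => (σ.bvar i).weaken)
  param := fun p => (σ.param p).weaken

/-- Simultaneous substitution in a term. -/
def Term.subst {k m : ℕ} (σ : Subst k m) : Term k → Term m
  | .bvar i => σ.bvar i
  | .param p => σ.param p
  | .zero => .zero
  | .succ t => .succ (t.subst σ)
  | .add s t => .add (s.subst σ) (t.subst σ)
  | .mul s t => .mul (s.subst σ) (t.subst σ)

/-- Simultaneous, capture-avoiding substitution in a formula. -/
def Formula.subst : {k m : ℕ} → Subst k m → Formula k → Formula m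
  | _, _, σ, .eq s t => .eq (s.subst σ) (t.subst σ)
  | _, _, σ, .neg A => .neg (A.subst σ)
  | _, _, σ, .and A B => .and (A.subst σ) (B.subst σ)
  | _, _, σ, .or A B => .or (A.subst σ) (B.subst σ)
  | _, _, σ, .imp A B => .imp (A.subst σ) (B.subst σ)
  | _, _, σ, .all A => .all (A.subst σ.lift)
  | _, _, σ, .ex A => .ex (A.subst σ.lift)

/-- Simultaneous substitution in a sequent. -/
def Sequent.subst (σ : Subst 0 0) (S : Sequent) : Sequent :=
  ⟨S.ante.map (Formula.subst σ), S.succ.map (Formula.subst σ)⟩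

/-- `A(t)`, where `A(x)` is the body of a quantified formula. -/
def Formula.inst (A : Formula 1) (t : Term 0) : Formula 0 :=
  A.subst ⟨fun _ => t, Term.param⟩

/-- The substitution `{n ← t}` for the active parameter `n`. -/
def substActive (n : ℕ) (t : Term 0) : Subst 0 0 where
  bvar := Term.bvar
  param := fun p => match p with
    | .active j => if j = n then t else .param (.active j)
    | .passive j => .param (.passive j)
    | .internal j => .param (.internal j)

/-- The substitution `{n ← t, 𝐦 ← a 𝐦 (𝐦 ∈ M)}` for the active parameter `n` and the internal
parameters in `M`. -/
def substActiveInternal (n : ℕ) (t : Term 0) (M : Finset ℕ) (a : ℕ → Term 0) : Subst 0 0 where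
  bvar := Term.bvar
  param := fun p => match p with
    | .active j => if j = n then t else .param (.active j)
    | .passive j => .param (.passive j)
    | .internal j => if j ∈ M then a j else .param (.internal j)

/-! ### The equational theory -/

/-- Equality of terms modulo the equational theory
`0 + t = t`, `s(u) + t = s(u + t)`, `0 * t = 0`, `s(u) * t = u * t + t`. -/
inductive TermEquiv {k : ℕ} : Term k → Term k → Prop
  | zero_add (t : Term k) : TermEquiv (.add .zero t) t
  | succ_add (u t : Term k) : TermEquiv (.add (.succ u) t) (.succ (.add u t))
  | zero_mul (t : Term k) : TermEquiv (.mul .zero t) .zero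
  | succ_mul (u t : Term k) : TermEquiv (.mul (.succ u) t) (.add (.mul u t) t)
  | refl (t : Term k) : TermEquiv t t
  | symm {s t : Term k} : TermEquiv s t → TermEquiv t s
  | trans {s t u : Term k} : TermEquiv s t → TermEquiv t u → TermEquiv s u
  | succ {s t : Term k} : TermEquiv s t → TermEquiv (.succ s) (.succ t)
  | add {s s' t t' : Term k} : TermEquiv s s' → TermEquiv t t' → TermEquiv (.add s t) (.add s' t')
  | mul {s s' t t' : Term k} : TermEquiv s s' → TermEquiv t t' → TermEquiv (.mul s t) (.mul s' t')

/-- Two formulas are equal modulo the equational theory if they arise from each other by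
replacing terms by equal terms. -/
inductive FormulaEquiv : {k : ℕ} → Formula k → Formula k → Prop
  | eq {k : ℕ} {s s' t t' : Term k} :
      TermEquiv s s' → TermEquiv t t' → FormulaEquiv (.eq s t) (.eq s' t')
  | neg {k : ℕ} {A A' : Formula k} : FormulaEquiv A A' → FormulaEquiv (.neg A) (.neg A')
  | and {k : ℕ} {A A' B B' : Formula k} :
      FormulaEquiv A A' → FormulaEquiv B B' → FormulaEquiv (.and A B) (.and A' B')
  | or {k : ℕ} {A A' B B' : Formula k} :
      FormulaEquiv A A' → FormulaEquiv B B' → FormulaEquiv (.or A B) (.or A' B')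
  | imp {k : ℕ} {A A' B B' : Formula k} :
      FormulaEquiv A A' → FormulaEquiv B B' → FormulaEquiv (.imp A B) (.imp A' B')
  | all {k : ℕ} {A A' : Formula (k + 1)} : FormulaEquiv A A' → FormulaEquiv (.all A) (.all A')
  | ex {k : ℕ} {A A' : Formula (k + 1)} : FormulaEquiv A A' → FormulaEquiv (.ex A) (.ex A')

/-! ### The inference rules -/

/-- The initial sequents: logical axioms, equality axioms, and the axioms of Peano arithmetic. -/
inductive Initial : Sequent → Prop
  | id (A : Formula 0) : Initial ⟨{A}, {A}⟩
  | eq_refl (t : Term 0) : Initial ⟨0, {.eq t t}⟩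
  | eq_succ (s t : Term 0) : Initial ⟨{.eq s t}, {.eq (.succ s) (.succ t)}⟩
  | eq_add (s₁ t₁ s₂ t₂ : Term 0) :
      Initial ⟨{.eq s₁ t₁, .eq s₂ t₂}, {.eq (.add s₁ s₂) (.add t₁ t₂)}⟩
  | eq_mul (s₁ t₁ s₂ t₂ : Term 0) :
      Initial ⟨{.eq s₁ t₁, .eq s₂ t₂}, {.eq (.mul s₁ s₂) (.mul t₁ t₂)}⟩
  | eq_eq (s₁ t₁ s₂ t₂ : Term 0) :
      Initial ⟨{.eq s₁ t₁, .eq s₂ t₂, .eq s₁ s₂}, {.eq t₁ t₂}⟩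
  | succ_ne_zero (t : Term 0) : Initial ⟨{.eq (.succ t) .zero}, 0⟩
  | succ_inj (s t : Term 0) : Initial ⟨{.eq (.succ s) (.succ t)}, {.eq s t}⟩
  | zero_add (t : Term 0) : Initial ⟨0, {.eq (.add .zero t) t}⟩
  | succ_add (u t : Term 0) : Initial ⟨0, {.eq (.add (.succ u) t) (.succ (.add u t))}⟩
  | zero_mul (t : Term 0) : Initial ⟨0, {.eq (.mul .zero t) .zero}⟩
  | succ_mul (u t : Term 0) : Initial ⟨0, {.eq (.mul (.succ u) t) (.add (.mul u t) t)}⟩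

/-- Active and internal parameters, and terms which contain them, cannot be quantified: a term may
only be quantified if all its parameters are passive. -/
def Term.Quantifiable (t : Term 0) : Prop := ∀ p ∈ t.params, ∃ i, p = Param.passive i

/-- The one-premise rules of `mvLKE`: premise, conclusion.  Passive parameters are the
eigenvariables. -/
inductive Unary : Sequent → Sequent → Prop
  | weakL (A : Formula 0) (Γ Δ : Multiset (Formula 0)) : Unary ⟨Γ, Δ⟩ ⟨A ::ₘ Γ, Δ⟩
  | weakR (A : Formula 0) (Γ Δ : Multiset (Formula 0)) : Unary ⟨Γ, Δ⟩ ⟨Γ, A ::ₘ Δ⟩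
  | contrL (A : Formula 0) (Γ Δ : Multiset (Formula 0)) :
      Unary ⟨A ::ₘ A ::ₘ Γ, Δ⟩ ⟨A ::ₘ Γ, Δ⟩
  | contrR (A : Formula 0) (Γ Δ : Multiset (Formula 0)) :
      Unary ⟨Γ, A ::ₘ A ::ₘ Δ⟩ ⟨Γ, A ::ₘ Δ⟩
  | negL (A : Formula 0) (Γ Δ : Multiset (Formula 0)) : Unary ⟨Γ, A ::ₘ Δ⟩ ⟨.neg A ::ₘ Γ, Δ⟩
  | negR (A : Formula 0) (Γ Δ : Multiset (Formula 0)) : Unary ⟨A ::ₘ Γ, Δ⟩ ⟨Γ, .neg A ::ₘ Δ⟩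
  | andL₁ (A B : Formula 0) (Γ Δ : Multiset (Formula 0)) :
      Unary ⟨A ::ₘ Γ, Δ⟩ ⟨.and A B ::ₘ Γ, Δ⟩
  | andL₂ (A B : Formula 0) (Γ Δ : Multiset (Formula 0)) :
      Unary ⟨B ::ₘ Γ, Δ⟩ ⟨.and A B ::ₘ Γ, Δ⟩
  | orR₁ (A B : Formula 0) (Γ Δ : Multiset (Formula 0)) :
      Unary ⟨Γ, A ::ₘ Δ⟩ ⟨Γ, .or A B ::ₘ Δ⟩
  | orR₂ (A B : Formula 0) (Γ Δ : Multiset (Formula 0)) :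
      Unary ⟨Γ, B ::ₘ Δ⟩ ⟨Γ, .or A B ::ₘ Δ⟩
  | impR (A B : Formula 0) (Γ Δ : Multiset (Formula 0)) :
      Unary ⟨A ::ₘ Γ, B ::ₘ Δ⟩ ⟨Γ, .imp A B ::ₘ Δ⟩
  | allL (A : Formula 1) (t : Term 0) (Γ Δ : Multiset (Formula 0)) : t.Quantifiable →
      Unary ⟨A.inst t ::ₘ Γ, Δ⟩ ⟨.all A ::ₘ Γ, Δ⟩
  | allR (A : Formula 1) (α : ℕ) (Γ Δ : Multiset (Formula 0)) :
      Param.passive α ∉ Sequent.params ⟨Γ, .all A ::ₘ Δ⟩ →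
      Unary ⟨Γ, A.inst (.param (.passive α)) ::ₘ Δ⟩ ⟨Γ, .all A ::ₘ Δ⟩
  | exL (A : Formula 1) (α : ℕ) (Γ Δ : Multiset (Formula 0)) :
      Param.passive α ∉ Sequent.params ⟨.ex A ::ₘ Γ, Δ⟩ →
      Unary ⟨A.inst (.param (.passive α)) ::ₘ Γ, Δ⟩ ⟨.ex A ::ₘ Γ, Δ⟩
  | exR (A : Formula 1) (t : Term 0) (Γ Δ : Multiset (Formula 0)) : t.Quantifiable →
      Unary ⟨Γ, A.inst t ::ₘ Δ⟩ ⟨Γ, .ex A ::ₘ Δ⟩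
  /-- the rule `ℰ` -/
  | equational (Γ Γ' Δ Δ' : Multiset (Formula 0)) :
      Multiset.Rel FormulaEquiv Γ Γ' → Multiset.Rel FormulaEquiv Δ Δ' → Unary ⟨Γ, Δ⟩ ⟨Γ', Δ'⟩

/-- The two-premise rules of `mvLKE`: left premise, right premise, conclusion. -/
inductive Binary : Sequent → Sequent → Sequent → Prop
  | cut (A : Formula 0) (Γ Δ Θ Λ : Multiset (Formula 0)) :
      Binary ⟨Γ, A ::ₘ Δ⟩ ⟨A ::ₘ Θ, Λ⟩ ⟨Γ + Θ, Δ + Λ⟩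
  | andR (A B : Formula 0) (Γ Δ : Multiset (Formula 0)) :
      Binary ⟨Γ, A ::ₘ Δ⟩ ⟨Γ, B ::ₘ Δ⟩ ⟨Γ, .and A B ::ₘ Δ⟩
  | orL (A B : Formula 0) (Γ Δ : Multiset (Formula 0)) :
      Binary ⟨A ::ₘ Γ, Δ⟩ ⟨B ::ₘ Γ, Δ⟩ ⟨.or A B ::ₘ Γ, Δ⟩
  | impL (A B : Formula 0) (Γ Δ Θ Λ : Multiset (Formula 0)) :
      Binary ⟨Γ, A ::ₘ Δ⟩ ⟨B ::ₘ Θ, Λ⟩ ⟨.imp A B ::ₘ (Γ + Θ), Δ + Λ⟩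

/-- The rule `mvIND`: premise `F(n, 𝐦), Γ ⊢ Δ, F(n', 𝐦)`, conclusion
`F(0, 𝐚), Γ ⊢ Δ, F(t, 𝐚)`, where the active parameter `n` and the internal parameters `𝐦`
(those in the finite set `M`) do not occur in `Γ, Δ`, and `t`, `𝐚` are arbitrary schematic terms. -/
inductive MvInd : Sequent → Sequent → Prop
  | mk (F : Formula 0) (n : ℕ) (M : Finset ℕ) (t : Term 0) (a : ℕ → Term 0)
      (Γ Δ : Multiset (Formula 0)) :
      Param.active n ∉ Sequent.params ⟨Γ, Δ⟩ →
      (∀ j ∈ M, Param.internal j ∉ Sequent.params ⟨Γ, Δ⟩) →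
      MvInd ⟨F ::ₘ Γ, F.subst (substActive n (.succ (.param (.active n)))) ::ₘ Δ⟩
        ⟨F.subst (substActiveInternal n .zero M a) ::ₘ Γ,
          F.subst (substActiveInternal n t M a) ::ₘ Δ⟩

/-! ### Derivations -/

/-- Derivation trees of the `mvLKE`-calculus extended by additional leaves (`Leaf S` is the type of
labels of the additional leaves with sequent `S`) and by additional one-premise rules `Rule`.
No sequent of a derivation has more than one active parameter. -/
inductive Derivation (Leaf : Sequent → Type) (Rule : Sequent → Sequent → Prop) : Sequent → Type
  | initial {S : Sequent} : S.AtMostOneActive → Initial S → Derivation Leaf Rule S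
  | leaf {S : Sequent} : S.AtMostOneActive → Leaf S → Derivation Leaf Rule S
  | unary {S S' : Sequent} : S'.AtMostOneActive → Unary S S' →
      Derivation Leaf Rule S → Derivation Leaf Rule S'
  | binary {S₁ S₂ S' : Sequent} : S'.AtMostOneActive → Binary S₁ S₂ S' →
      Derivation Leaf Rule S₁ → Derivation Leaf Rule S₂ → Derivation Leaf Rule S'
  | rule {S S' : Sequent} : S'.AtMostOneActive → Rule S S' →
      Derivation Leaf Rule S → Derivation Leaf Rule S'

/-- The sequents occurring in a derivation. -/
def Derivation.sequents {Leaf : Sequent → Type} {Rule : Sequent → Sequent → Prop} :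
    {S : Sequent} → Derivation Leaf Rule S → Set Sequent
  | S, .initial _ _ => {S}
  | S, .leaf _ _ => {S}
  | S, .unary _ _ d => {S} ∪ d.sequents
  | S, .binary _ _ d₁ d₂ => {S} ∪ d₁.sequents ∪ d₂.sequents
  | S, .rule _ _ d => {S} ∪ d.sequents

/-- The additional leaves occurring in a derivation, with their sequents. -/
def Derivation.leaves {Leaf : Sequent → Type} {Rule : Sequent → Sequent → Prop} :
    {S : Sequent} → Derivation Leaf Rule S → Set (Σ S, Leaf S)
  | _, .initial _ _ => ∅
  | S, .leaf _ ℓ => {⟨S, ℓ⟩}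
  | _, .unary _ _ d => d.leaves
  | _, .binary _ _ d₁ d₂ => d₁.leaves ∪ d₂.leaves
  | _, .rule _ _ d => d.leaves

/-- A link: a proof symbol, the argument for the active parameter of the component it refers to,
and the arguments for the internal and the passive parameters of that component. -/
structure Link : Type where
  symbol : ℕ
  arg : Term 0
  internalArg : ℕ → Term 0
  passiveArg : ℕ → Term 0

/-- The substitution of the arguments of a link for the parameters. -/
def Link.subst (ℓ : Link) : Subst 0 0 where
  bvar := Term.bvar
  param := fun p => match p with
    | .active _ => ℓ.arg
    | .passive j => ℓ.passiveArg j
    | .internal j => ℓ.internalArg j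

/-- `mvLKS`-derivations of `S`: links may appear at the leaves. -/
abbrev MvLKS (S : Sequent) : Type := Derivation (fun _ => Link) (fun _ _ => False) S

/-- `mvLKIE`-derivations of `S`: the rule `mvIND` is added, and there are no links. -/
abbrev MvLKIE (S : Sequent) : Type := Derivation (fun _ => Empty) MvInd S

/-! ### Components and `P`-schemata -/

/-- An `(n, I)`-component `(ψ, π, ν)` with end-sequent `S`: the base case `π` is an inactive
derivation of `S{n ← 0}`, the step case `ν` is an `{n}`-active derivation of `S{n ← n'}`. -/
structure Component : Type where
  symbol : ℕ
  n : ℕ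
  I : Set ℕ
  endSequent : Sequent
  actives_subset : endSequent.actives ⊆ {n}
  internals_eq : endSequent.internals = I
  base : MvLKS (endSequent.subst (substActive n .zero))
  step : MvLKS (endSequent.subst (substActive n (.succ (.param (.active n)))))
  base_inactive : ∀ T ∈ base.sequents, T.actives = ∅
  step_active : ∀ T ∈ step.sequents, T.actives ⊆ {n}

/-- The links in a component, with the sequents they are associated with. -/
def Component.links (C : Component) : Set (Σ _ : Sequent, Link) :=
  C.base.leaves ∪ C.step.leaves

/-- The passive parameters occurring in a component. -/
def Component.passives (C : Component) : Set ℕ :=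
  {α | (∃ T ∈ C.base.sequents, α ∈ T.passives) ∨ ∃ T ∈ C.step.sequents, α ∈ T.passives}

/-- `(C, D)`-linkability. -/
def Component.Linkable (C D : Component) : Prop :=
  ∀ (T : Sequent) (ℓ : Link), ⟨T, ℓ⟩ ∈ C.links → ℓ.symbol = D.symbol →
    D.endSequent.passives ⊆ T.passives

/-- The linkability ordering `C ≺ D`. -/
def Component.Precedes (C D : Component) : Prop := C ≠ D ∧ C.Linkable D

/-- A `P`-schema `⟨C₀, …, C_length⟩` over the well-founded suborder `lt` of the linkability
ordering.  A link refers to a component that is above the linking one in `lt`, or it is a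
recursive call inside a step case, made at the predecessor `n` of `n'`; the sequent of a link is the
corresponding instance of the end-sequent of the component it refers to. -/
structure PSchema (P : Set ℕ) : Type where
  length : ℕ
  comp : Fin (length + 1) → Component
  symbol_injective : Function.Injective fun i => (comp i).symbol
  passives_subset : ∀ i, (comp i).passives ⊆ P
  lt : Fin (length + 1) → Fin (length + 1) → Prop
  lt_trans : ∀ i j k, lt i j → lt j k → lt i k
  lt_wellFounded : WellFounded lt
  lt_precedes : ∀ i j, lt i j → (comp i).Precedes (comp j)
  lt_least : ∀ i, i ≠ 0 → lt 0 i
  link_base : ∀ i (T : Sequent) (ℓ : Link), ⟨T, ℓ⟩ ∈ (comp i).base.leaves →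
    ∃ j, ℓ.symbol = (comp j).symbol ∧ T = (comp j).endSequent.subst ℓ.subst ∧ lt i j
  link_step : ∀ i (T : Sequent) (ℓ : Link), ⟨T, ℓ⟩ ∈ (comp i).step.leaves →
    ∃ j, ℓ.symbol = (comp j).symbol ∧ T = (comp j).endSequent.subst ℓ.subst ∧
      (lt i j ∨ (j = i ∧ ℓ.arg = .param (.active (comp i).n)))

/-- The end-sequent of a `P`-schema is the end-sequent of its least component. -/
def PSchema.endSequent {P : Set ℕ} (Ψ : PSchema P) : Sequent := (Ψ.comp 0).endSequent

end PSchemata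

namespace PSchemata

/-! ### Substitution lemmas -/

/-! From schemata to induction. Two features of links stand in the way. A link may put arbitrary
terms for passive parameters, although quantifier rules only accept terms with passive parameters
alone, so such a substitution cannot simply be pushed through a derivation. And a recursive call
fixes only the active argument, while the induction rule assumes its hypothesis for the very same
passive and internal parameters.

The first difficulty is met by the notion `Uniform`: every instance that replaces all parameters by
quantifiable terms is derivable. Uniform sequents are closed under the rules of the calculus and
under all substitutions, and quantifying any term becomes admissible, because after instantiation
every term is quantifiable. Nothing is lost: by induction `∃ x, x = q` is derivable for each
parameter `q`, so a passive parameter can be traded for `q` by replacing equals under the hypothesis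
`β = q`, binding `β` and cutting (`mvLKIE_subst_single`). Undoing the instantiation one parameter at
a time gives `Uniform.derivable`.

The second difficulty is met by universal closure (`uniform_of_step`). A sequent is coded as a
formula and closed over all its parameters except `n`; the result `G(n)` yields every recursive
call. Carried as an additional hypothesis through the step case, it gives `G(n) ⊢ G(s(n))`; the base
case gives `G(0)`. Since `G` has no passive parameter, it disturbs no eigenvariable condition.
Components are handled downwards along the order of the schema (`PSchema.uniform`), which works
because there are finitely many.

From induction to schemata. An inference with premise `F(n), Γ ⊢ Δ, F(s(n))` becomes a component
with end-sequent `F(0), Γ ⊢ Δ, F(n)`: its base case is an axiom, its step case cuts a recursive call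
against the translated premise, and the conclusion is a link to it (`Translatable.mvInd`).
Components are stacked on a list in which links only go to the component itself or towards the tail.
The invariant `Translatable` allows a term `u` in place of the active parameter, since a component
needs its sequent at `0` and at `s(n)`; the list is chosen before `u`, so both cases share it. -/

theorem Subst.ext' {k m : ℕ} {σ τ : Subst k m} (hb : ∀ i, σ.bvar i = τ.bvar i)
    (hp : ∀ p, σ.param p = τ.param p) : σ = τ := by
  cases σ; cases τ
  congr
  · exact funext hb
  · exact funext hp

/-- Composition of substitutions: first `σ`, then `τ`. -/
def Subst.comp {k l m : ℕ} (σ : Subst k l) (τ : Subst l m) : Subst k m where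
  bvar := fun i => (σ.bvar i).subst τ
  param := fun p => (σ.param p).subst τ

/-- The identity substitution. -/
def Subst.id (k : ℕ) : Subst k k := ⟨Term.bvar, Term.param⟩

theorem Term.params_weaken {k : ℕ} (t : Term k) : t.weaken.params = t.params := by
  induction t <;> simp_all [Term.weaken, Term.params]

theorem Term.subst_weaken {k m : ℕ} (σ : Subst k m) (t : Term k) :
    t.weaken.subst σ.lift = (t.subst σ).weaken := by
  induction t <;> simp_all [Term.weaken, Term.subst, Subst.lift]

theorem Term.subst_congr {k m : ℕ} {σ τ : Subst k m} (t : Term k)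
    (hb : ∀ i, σ.bvar i = τ.bvar i) (hp : ∀ p ∈ t.params, σ.param p = τ.param p) :
    t.subst σ = t.subst τ := by
  induction t <;> simp_all [Term.subst, Term.params]

theorem Term.subst_subst {k l m : ℕ} (σ : Subst k l) (τ : Subst l m) (t : Term k) :
    (t.subst σ).subst τ = t.subst (σ.comp τ) := by
  induction t <;> simp_all [Term.subst, Subst.comp]

theorem Term.subst_id {k : ℕ} (t : Term k) : t.subst (Subst.id k) = t := by
  induction t <;> simp_all [Term.subst, Subst.id]

theorem Term.weaken_eq_subst {k : ℕ} (t : Term k) :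
    t.weaken = t.subst ⟨fun i => .bvar i.succ, .param⟩ := by
  induction t <;> simp_all [Term.subst, Term.weaken]

theorem Subst.lift_comp {k l m : ℕ} (σ : Subst k l) (τ : Subst l m) :
    (σ.comp τ).lift = σ.lift.comp τ.lift := by
  apply Subst.ext'
  · intro i
    refine Fin.cases ?_ (fun i => ?_) i
    · simp [Subst.lift, Subst.comp, Term.subst]
    · exact (Term.subst_weaken _ _).symm
  · intro p
    exact (Term.subst_weaken _ _).symm

theorem Subst.lift_id (k : ℕ) : (Subst.id k).lift = Subst.id (k + 1) := by
  apply Subst.ext'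
  · intro i
    refine Fin.cases ?_ (fun i => ?_) i <;> simp [Subst.lift, Subst.id, Term.weaken]
  · intro p
    simp [Subst.lift, Subst.id, Term.weaken]

theorem Formula.subst_congr {k : ℕ} (A : Formula k) : ∀ {m : ℕ} {σ τ : Subst k m},
    (∀ i, σ.bvar i = τ.bvar i) → (∀ p ∈ A.params, σ.param p = τ.param p) →
    A.subst σ = A.subst τ := by
  have lift : ∀ {k m : ℕ} {σ τ : Subst k m} {P : Set Param}, (∀ i, σ.bvar i = τ.bvar i) →
      (∀ p ∈ P, σ.param p = τ.param p) → (∀ i, σ.lift.bvar i = τ.lift.bvar i) ∧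
      (∀ p ∈ P, σ.lift.param p = τ.lift.param p) := by
    intro k m σ τ P hb hp
    refine ⟨fun i => ?_, fun p h => by simp [Subst.lift, hp p h]⟩
    refine Fin.cases ?_ (fun i => ?_) i <;> simp [Subst.lift, hb]
  induction A with
  | eq s t =>
    intro m σ τ hb hp
    simp only [Formula.subst]
    rw [s.subst_congr hb fun p h => hp p (Or.inl h), t.subst_congr hb fun p h => hp p (Or.inr h)]
  | neg A ih => intro m σ τ hb hp; simp only [Formula.subst]; rw [ih hb hp]
  | and A B ihA ihB | or A B ihA ihB | imp A B ihA ihB =>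
    intro m σ τ hb hp
    simp only [Formula.subst]
    rw [ihA hb fun p h => hp p (Or.inl h), ihB hb fun p h => hp p (Or.inr h)]
  | all A ih | ex A ih =>
    intro m σ τ hb hp
    simp only [Formula.subst]
    rw [ih (lift hb hp).1 (lift hb hp).2]

theorem Formula.subst_subst {k : ℕ} (A : Formula k) : ∀ {l m : ℕ} (σ : Subst k l) (τ : Subst l m),
    (A.subst σ).subst τ = A.subst (σ.comp τ) := by
  induction A <;> intros <;> simp_all [Formula.subst, Term.subst_subst, Subst.lift_comp]

theorem Formula.subst_id {k : ℕ} (A : Formula k) : A.subst (Subst.id k) = A := by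
  induction A <;> simp_all [Formula.subst, Term.subst_id, Subst.lift_id]

theorem Formula.subst_eq_self (A : Formula 0) {σ : Subst 0 0}
    (h : ∀ p ∈ A.params, σ.param p = .param p) : A.subst σ = A :=
  (A.subst_congr (fun i => i.elim0) h).trans A.subst_id

theorem Term.subst_eq_self (t : Term 0) {σ : Subst 0 0}
    (h : ∀ p ∈ t.params, σ.param p = .param p) : t.subst σ = t :=
  (t.subst_congr (fun i => i.elim0) h).trans t.subst_id

theorem Term.mem_params_subst {k m : ℕ} {σ : Subst k m} {t : Term k} {p : Param}
    (h : p ∈ (t.subst σ).params) :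
    (∃ i, p ∈ (σ.bvar i).params) ∨ ∃ q ∈ t.params, p ∈ (σ.param q).params := by
  induction t with
  | bvar i => exact Or.inl ⟨i, h⟩
  | param q => exact Or.inr ⟨q, rfl, h⟩
  | zero => exact h.elim
  | succ t ih => exact ih h
  | add s t ihs iht | mul s t ihs iht =>
    rcases h with h | h
    · exact (ihs h).imp_right fun ⟨q, hq, h⟩ => ⟨q, Or.inl hq, h⟩
    · exact (iht h).imp_right fun ⟨q, hq, h⟩ => ⟨q, Or.inr hq, h⟩

theorem Formula.mem_params_subst {k : ℕ} {A : Formula k} : ∀ {m : ℕ} {σ : Subst k m} {p : Param},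
    p ∈ (A.subst σ).params →
    (∃ i, p ∈ (σ.bvar i).params) ∨ ∃ q ∈ A.params, p ∈ (σ.param q).params := by
  induction A with
  | eq s t =>
    intro m σ p h
    rcases h with h | h
    · exact (Term.mem_params_subst h).imp_right fun ⟨q, hq, h⟩ => ⟨q, Or.inl hq, h⟩
    · exact (Term.mem_params_subst h).imp_right fun ⟨q, hq, h⟩ => ⟨q, Or.inr hq, h⟩
  | neg A ih => intro m σ p h; exact ih h
  | and A B ihA ihB | or A B ihA ihB | imp A B ihA ihB =>
    intro m σ p h
    rcases h with h | h
    · exact (ihA h).imp_right fun ⟨q, hq, h⟩ => ⟨q, Or.inl hq, h⟩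
    · exact (ihB h).imp_right fun ⟨q, hq, h⟩ => ⟨q, Or.inr hq, h⟩
  | all A ih | ex A ih =>
    intro m σ p h
    rcases ih h with ⟨i, hi⟩ | ⟨q, hq, h⟩
    · revert hi
      refine Fin.cases ?_ (fun i => ?_) i
      · intro h; exact h.elim
      · intro h; exact Or.inl ⟨i, by simpa [Subst.lift, Term.params_weaken] using h⟩
    · exact Or.inr ⟨q, hq, by simpa [Subst.lift, Term.params_weaken] using h⟩

theorem Formula.mem_params_subst_zero {A : Formula 0} {m : ℕ} {σ : Subst 0 m} {p : Param}
    (h : p ∈ (A.subst σ).params) : ∃ q ∈ A.params, p ∈ (σ.param q).params :=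
  (Formula.mem_params_subst h).resolve_left fun ⟨i, _⟩ => i.elim0

theorem Term.params_subst_of_mem {k m : ℕ} {σ : Subst k m} {t : Term k} {p q : Param}
    (hq : q ∈ t.params) (h : p ∈ (σ.param q).params) : p ∈ (t.subst σ).params := by
  induction t with
  | bvar i => exact hq.elim
  | param r => cases hq; exact h
  | zero => exact hq.elim
  | succ t ih => exact ih hq
  | add s t ihs iht | mul s t ihs iht => exact hq.imp ihs iht

theorem Formula.params_subst_of_mem {k : ℕ} {A : Formula k} :
    ∀ {m : ℕ} {σ : Subst k m} {p q : Param},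
    q ∈ A.params → p ∈ (σ.param q).params → p ∈ (A.subst σ).params := by
  induction A with
  | eq s t =>
    intro m σ p q hq h
    exact hq.imp (fun hq => Term.params_subst_of_mem hq h) fun hq => Term.params_subst_of_mem hq h
  | neg A ih => intro m σ p q hq h; exact ih hq h
  | and A B ihA ihB | or A B ihA ihB | imp A B ihA ihB =>
    intro m σ p q hq h
    exact hq.imp (fun hq => ihA hq h) fun hq => ihB hq h
  | all A ih | ex A ih =>
    intro m σ p q hq h
    exact ih hq (by simpa [Subst.lift, Term.params_weaken] using h)

theorem Formula.subst_lift_inst {k : ℕ} (A : Formula (k + 1)) (σ : Subst k 0) (t : Term 0) :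
    (A.subst σ.lift).inst t = A.subst ⟨Fin.cases t σ.bvar, σ.param⟩ := by
  have key : ∀ u : Term 0, u.weaken.subst ⟨fun _ => t, Term.param⟩ = u := by
    intro u
    rw [Term.weaken_eq_subst, Term.subst_subst]
    exact Term.subst_eq_self u fun p _ => rfl
  rw [Formula.inst, Formula.subst_subst]
  congr 1
  apply Subst.ext'
  · intro i
    refine Fin.cases rfl (fun i => ?_) i
    exact key _
  · intro p
    exact key _

theorem Formula.inst_subst (A : Formula 1) (t : Term 0) (σ : Subst 0 0) :
    (A.inst t).subst σ = (A.subst σ.lift).inst (t.subst σ) := by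
  rw [Formula.subst_lift_inst, Formula.inst, Formula.subst_subst]
  congr 1
  apply Subst.ext'
  · intro i
    refine Fin.cases rfl (fun i => i.elim0) i
  · intro p
    rfl

theorem Term.Quantifiable.subst {t : Term 0} (ht : t.Quantifiable) {σ : Subst 0 0}
    (hσ : ∀ α, (σ.param (.passive α)).Quantifiable) : (t.subst σ).Quantifiable := by
  intro p hp
  rcases Term.mem_params_subst hp with ⟨i, _⟩ | ⟨q, hq, h⟩
  · exact i.elim0
  · obtain ⟨α, rfl⟩ := ht q hq
    exact hσ α p h

theorem Term.Quantifiable.subst_of_forall (t : Term 0) {σ : Subst 0 0}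
    (hσ : ∀ p, (σ.param p).Quantifiable) : (t.subst σ).Quantifiable := by
  intro p hp
  rcases Term.mem_params_subst hp with ⟨i, _⟩ | ⟨q, hq, h⟩
  · exact i.elim0
  · exact hσ q p h

theorem TermEquiv.subst {k m : ℕ} {s t : Term k} (h : TermEquiv s t) (σ : Subst k m) :
    TermEquiv (s.subst σ) (t.subst σ) := by
  induction h with
  | zero_add t => exact .zero_add _
  | succ_add u t => exact .succ_add _ _
  | zero_mul t => exact .zero_mul _
  | succ_mul u t => exact .succ_mul _ _
  | refl t => exact .refl _
  | symm _ ih => exact .symm ih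
  | trans _ _ ih₁ ih₂ => exact .trans ih₁ ih₂
  | succ _ ih => exact .succ ih
  | add _ _ ih₁ ih₂ => exact .add ih₁ ih₂
  | mul _ _ ih₁ ih₂ => exact .mul ih₁ ih₂

theorem FormulaEquiv.subst {k : ℕ} {A B : Formula k} (h : FormulaEquiv A B) :
    ∀ {m : ℕ} (σ : Subst k m), FormulaEquiv (A.subst σ) (B.subst σ) := by
  induction h with
  | eq h₁ h₂ => exact fun σ => .eq (h₁.subst σ) (h₂.subst σ)
  | neg _ ih => exact fun σ => .neg (ih σ)
  | and _ _ ih₁ ih₂ => exact fun σ => .and (ih₁ σ) (ih₂ σ)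
  | or _ _ ih₁ ih₂ => exact fun σ => .or (ih₁ σ) (ih₂ σ)
  | imp _ _ ih₁ ih₂ => exact fun σ => .imp (ih₁ σ) (ih₂ σ)
  | all _ ih => exact fun σ => .all (ih _)
  | ex _ ih => exact fun σ => .ex (ih _)

theorem FormulaEquiv.refl {k : ℕ} (A : Formula k) : FormulaEquiv A A := by
  induction A with
  | eq s t => exact .eq (.refl s) (.refl t)
  | neg _ ih => exact .neg ih
  | and _ _ ih₁ ih₂ => exact .and ih₁ ih₂
  | or _ _ ih₁ ih₂ => exact .or ih₁ ih₂
  | imp _ _ ih₁ ih₂ => exact .imp ih₁ ih₂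
  | all _ ih => exact .all ih
  | ex _ ih => exact .ex ih

/-! ### Sequents under substitution -/

theorem Sequent.mem_params {S : Sequent} {p : Param} :
    p ∈ S.params ↔ (∃ A ∈ S.ante, p ∈ A.params) ∨ ∃ A ∈ S.succ, p ∈ A.params := Iff.rfl

theorem Sequent.subst_congr {S : Sequent} {σ τ : Subst 0 0}
    (h : ∀ p ∈ S.params, σ.param p = τ.param p) : S.subst σ = S.subst τ := by
  simp only [Sequent.subst, Sequent.mk.injEq]
  exact ⟨Multiset.map_congr rfl fun A hA =>
      A.subst_congr (fun i => i.elim0) fun p hp => h p (Or.inl ⟨A, hA, hp⟩),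
    Multiset.map_congr rfl fun A hA =>
      A.subst_congr (fun i => i.elim0) fun p hp => h p (Or.inr ⟨A, hA, hp⟩)⟩

theorem Sequent.subst_subst (S : Sequent) (σ τ : Subst 0 0) :
    (S.subst σ).subst τ = S.subst (σ.comp τ) := by
  simp [Sequent.subst, Multiset.map_map, Formula.subst_subst]

theorem Sequent.subst_id (S : Sequent) : S.subst (Subst.id 0) = S := by
  simp [Sequent.subst, Formula.subst_id]

theorem Sequent.subst_eq_self {S : Sequent} {σ : Subst 0 0}
    (h : ∀ p ∈ S.params, σ.param p = .param p) : S.subst σ = S :=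
  (Sequent.subst_congr h).trans S.subst_id

theorem Sequent.mem_params_subst {S : Sequent} {σ : Subst 0 0} {p : Param} :
    p ∈ (S.subst σ).params ↔ ∃ q ∈ S.params, p ∈ (σ.param q).params := by
  simp only [Sequent.mem_params, Sequent.subst, Multiset.mem_map]
  constructor
  · rintro (⟨_, ⟨A, hA, rfl⟩, h⟩ | ⟨_, ⟨A, hA, rfl⟩, h⟩)
    · obtain ⟨q, hq, h⟩ := Formula.mem_params_subst_zero h
      exact ⟨q, Or.inl ⟨A, hA, hq⟩, h⟩
    · obtain ⟨q, hq, h⟩ := Formula.mem_params_subst_zero h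
      exact ⟨q, Or.inr ⟨A, hA, hq⟩, h⟩
  · rintro ⟨q, ⟨A, hA, hq⟩ | ⟨A, hA, hq⟩, h⟩
    · exact Or.inl ⟨_, ⟨A, hA, rfl⟩, Formula.params_subst_of_mem hq h⟩
    · exact Or.inr ⟨_, ⟨A, hA, rfl⟩, Formula.params_subst_of_mem hq h⟩

/-! ### Finiteness of the set of parameters -/

theorem Term.params_finite {k : ℕ} (t : Term k) : t.params.Finite := by
  induction t <;> simp_all [Term.params]

theorem Formula.params_finite {k : ℕ} (A : Formula k) : A.params.Finite := by
  induction A <;> simp_all [Formula.params, Term.params_finite]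

theorem Sequent.params_finite (S : Sequent) : S.params.Finite := by
  have h : ∀ Γ : Multiset (Formula 0), {p | ∃ A ∈ Γ, p ∈ A.params}.Finite := by
    intro Γ
    refine Multiset.induction_on Γ (by simp) fun A Γ ih => ?_
    refine (A.params_finite.union ih).subset ?_
    rintro p ⟨B, hB, hp⟩
    rcases Multiset.mem_cons.1 hB with rfl | hB
    · exact Or.inl hp
    · exact Or.inr ⟨B, hB, hp⟩
  exact ((h S.ante).union (h S.succ)).subset fun p hp => hp

/-- A bound above which every passive parameter is outside of a given finite set. -/
theorem exists_passive_bound {P : Set Param} (hP : P.Finite) :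
    ∃ N : ℕ, ∀ α, .passive α ∈ P → α < N := by
  have hinj : Function.Injective Param.passive := fun a b h => by cases h; rfl
  obtain ⟨N, hN⟩ := (hP.preimage (f := Param.passive) hinj.injOn).bddAbove
  exact ⟨N + 1, fun α hα => Nat.lt_succ_of_le (hN hα)⟩

/-! ### Inference rules under substitution -/

theorem Initial.subst {S : Sequent} (h : Initial S) (σ : Subst 0 0) : Initial (S.subst σ) := by
  cases h with
  | id A => simpa [Sequent.subst, Formula.subst, Term.subst] using Initial.id (A.subst σ)
  | eq_refl t =>
    simpa [Sequent.subst, Formula.subst, Term.subst] using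
      Initial.eq_refl (t.subst σ)
  | eq_succ s t =>
    simpa [Sequent.subst, Formula.subst, Term.subst] using
      Initial.eq_succ (s.subst σ) (t.subst σ)
  | eq_add s₁ t₁ s₂ t₂ =>
    simpa [Sequent.subst, Formula.subst, Term.subst] using
      Initial.eq_add (s₁.subst σ) (t₁.subst σ) (s₂.subst σ) (t₂.subst σ)
  | eq_mul s₁ t₁ s₂ t₂ =>
    simpa [Sequent.subst, Formula.subst, Term.subst] using
      Initial.eq_mul (s₁.subst σ) (t₁.subst σ) (s₂.subst σ) (t₂.subst σ)
  | eq_eq s₁ t₁ s₂ t₂ =>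
    simpa [Sequent.subst, Formula.subst, Term.subst] using
      Initial.eq_eq (s₁.subst σ) (t₁.subst σ) (s₂.subst σ) (t₂.subst σ)
  | succ_ne_zero t =>
    simpa [Sequent.subst, Formula.subst, Term.subst] using
      Initial.succ_ne_zero (t.subst σ)
  | succ_inj s t =>
    simpa [Sequent.subst, Formula.subst, Term.subst] using
      Initial.succ_inj (s.subst σ) (t.subst σ)
  | zero_add t =>
    simpa [Sequent.subst, Formula.subst, Term.subst] using
      Initial.zero_add (t.subst σ)
  | succ_add u t =>
    simpa [Sequent.subst, Formula.subst, Term.subst] using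
      Initial.succ_add (u.subst σ) (t.subst σ)
  | zero_mul t =>
    simpa [Sequent.subst, Formula.subst, Term.subst] using
      Initial.zero_mul (t.subst σ)
  | succ_mul u t =>
    simpa [Sequent.subst, Formula.subst, Term.subst] using
      Initial.succ_mul (u.subst σ) (t.subst σ)

theorem rel_formulaEquiv_map {Γ Γ' : Multiset (Formula 0)} (h : Multiset.Rel FormulaEquiv Γ Γ')
    (σ : Subst 0 0) :
    Multiset.Rel FormulaEquiv (Γ.map (Formula.subst σ)) (Γ'.map (Formula.subst σ)) :=
  Multiset.rel_map.2 (h.mono fun _ _ _ _ h => h.subst σ)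

/-- An eigenvariable is absent from the conclusion, and this is all that is known of it from outside
the rule. Hence `hf` asks that every absent passive parameter be renamed to one that is fresh for
the substituted conclusion. -/
theorem Unary.subst {S S' : Sequent} (h : Unary S S') {σ : Subst 0 0}
    (hq : ∀ α, (σ.param (.passive α)).Quantifiable)
    (hf : ∀ α, .passive α ∉ S'.params → ∃ β, σ.param (.passive α) = .param (.passive β) ∧
      ∀ q ∈ S'.params, .passive β ∉ (σ.param q).params) :
    Unary (S.subst σ) (S'.subst σ) := by
  cases h with
  | weakL A Γ Δ => simpa [Sequent.subst, Formula.subst, Term.subst] using Unary.weakL _ _ _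
  | weakR A Γ Δ => simpa [Sequent.subst, Formula.subst, Term.subst] using Unary.weakR _ _ _
  | contrL A Γ Δ => simpa [Sequent.subst, Formula.subst, Term.subst] using Unary.contrL _ _ _
  | contrR A Γ Δ => simpa [Sequent.subst, Formula.subst, Term.subst] using Unary.contrR _ _ _
  | negL A Γ Δ => simpa [Sequent.subst, Formula.subst, Term.subst] using Unary.negL _ _ _
  | negR A Γ Δ => simpa [Sequent.subst, Formula.subst, Term.subst] using Unary.negR _ _ _
  | andL₁ A B Γ Δ => simpa [Sequent.subst, Formula.subst, Term.subst] using Unary.andL₁ _ _ _ _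
  | andL₂ A B Γ Δ => simpa [Sequent.subst, Formula.subst, Term.subst] using Unary.andL₂ _ _ _ _
  | orR₁ A B Γ Δ => simpa [Sequent.subst, Formula.subst, Term.subst] using Unary.orR₁ _ _ _ _
  | orR₂ A B Γ Δ => simpa [Sequent.subst, Formula.subst, Term.subst] using Unary.orR₂ _ _ _ _
  | impR A B Γ Δ => simpa [Sequent.subst, Formula.subst, Term.subst] using Unary.impR _ _ _ _
  | allL A t Γ Δ ht =>
    simp only [Sequent.subst, Multiset.map_cons, Formula.inst_subst, Formula.subst]
    exact Unary.allL _ _ _ _ (ht.subst hq)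
  | exR A t Γ Δ ht =>
    simp only [Sequent.subst, Multiset.map_cons, Formula.inst_subst, Formula.subst]
    exact Unary.exR _ _ _ _ (ht.subst hq)
  | allR A α Γ Δ hα =>
    obtain ⟨β, hβ, hfresh⟩ := hf α hα
    have hS : .passive β ∉ (Sequent.subst σ ⟨Γ, .all A ::ₘ Δ⟩).params := by
      rw [Sequent.mem_params_subst]
      rintro ⟨q, hq, h⟩
      exact hfresh q hq h
    simp only [Sequent.subst, Multiset.map_cons, Formula.inst_subst, Formula.subst, Term.subst,
      hβ] at hS ⊢
    exact Unary.allR _ _ _ _ hS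
  | exL A α Γ Δ hα =>
    obtain ⟨β, hβ, hfresh⟩ := hf α hα
    have hS : .passive β ∉ (Sequent.subst σ ⟨.ex A ::ₘ Γ, Δ⟩).params := by
      rw [Sequent.mem_params_subst]
      rintro ⟨q, hq, h⟩
      exact hfresh q hq h
    simp only [Sequent.subst, Multiset.map_cons, Formula.inst_subst, Formula.subst, Term.subst,
      hβ] at hS ⊢
    exact Unary.exL _ _ _ _ hS
  | equational Γ Γ' Δ Δ' h₁ h₂ =>
    exact Unary.equational _ _ _ _ (rel_formulaEquiv_map h₁ σ) (rel_formulaEquiv_map h₂ σ)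

/-- Without passive parameters in `Θ`, no eigenvariable can clash with the added context. -/
theorem Unary.add_left {S S' : Sequent} (h : Unary S S') {Θ : Multiset (Formula 0)}
    (hΘ : ∀ A ∈ Θ, ∀ α, .passive α ∉ A.params) :
    Unary ⟨Θ + S.ante, S.succ⟩ ⟨Θ + S'.ante, S'.succ⟩ := by
  cases h with
  | weakL A Γ Δ => simpa using Unary.weakL _ _ _
  | weakR A Γ Δ => simpa using Unary.weakR _ _ _
  | contrL A Γ Δ => simpa using Unary.contrL _ _ _
  | contrR A Γ Δ => simpa using Unary.contrR _ _ _
  | negL A Γ Δ => simpa using Unary.negL _ _ _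
  | negR A Γ Δ => simpa using Unary.negR _ _ _
  | andL₁ A B Γ Δ => simpa using Unary.andL₁ _ _ _ _
  | andL₂ A B Γ Δ => simpa using Unary.andL₂ _ _ _ _
  | orR₁ A B Γ Δ => simpa using Unary.orR₁ _ _ _ _
  | orR₂ A B Γ Δ => simpa using Unary.orR₂ _ _ _ _
  | impR A B Γ Δ => simpa using Unary.impR _ _ _ _
  | allL A t Γ Δ ht => simpa using Unary.allL _ _ _ _ ht
  | exR A t Γ Δ ht => simpa using Unary.exR _ _ _ _ ht
  | allR A α Γ Δ hα =>
    refine Unary.allR _ _ _ _ ?_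
    rintro (⟨B, hB, h⟩ | h)
    · rcases Multiset.mem_add.1 hB with hB | hB
      · exact hΘ B hB α h
      · exact hα (Or.inl ⟨B, hB, h⟩)
    · exact hα (Or.inr h)
  | exL A α Γ Δ hα =>
    simp only [Multiset.add_cons]
    refine Unary.exL _ _ _ _ ?_
    rintro (⟨B, hB, h⟩ | h)
    · rw [← Multiset.add_cons] at hB
      rcases Multiset.mem_add.1 hB with hB | hB
      · exact hΘ B hB α h
      · exact hα (Or.inl ⟨B, hB, h⟩)
    · exact hα (Or.inr h)
  | equational Γ Γ' Δ Δ' h₁ h₂ =>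
    exact Unary.equational _ _ _ _
      ((Multiset.rel_refl_of_refl_on fun A _ => FormulaEquiv.refl A).add h₁) h₂

theorem Binary.subst {S₁ S₂ S' : Sequent} (h : Binary S₁ S₂ S') (σ : Subst 0 0) :
    Binary (S₁.subst σ) (S₂.subst σ) (S'.subst σ) := by
  cases h with
  | cut A Γ Δ Θ Λ => simpa [Sequent.subst, Formula.subst, Term.subst] using Binary.cut _ _ _ _ _
  | andR A B Γ Δ => simpa [Sequent.subst, Formula.subst, Term.subst] using Binary.andR _ _ _ _
  | orL A B Γ Δ => simpa [Sequent.subst, Formula.subst, Term.subst] using Binary.orL _ _ _ _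
  | impL A B Γ Δ Θ Λ => simpa [Sequent.subst, Formula.subst, Term.subst] using Binary.impL _ _ _ _ _ _

/-! ### Calculi for sequents with restricted active parameters -/

/-- The active parameters of a formula. -/
def Formula.actives {k : ℕ} (A : Formula k) : Set ℕ := {n | .active n ∈ A.params}

theorem Sequent.actives_subset_iff {S : Sequent} {W : Set ℕ} :
    S.actives ⊆ W ↔ (∀ A ∈ S.ante, A.actives ⊆ W) ∧ ∀ A ∈ S.succ, A.actives ⊆ W := by
  constructor
  · exact fun h => ⟨fun A hA n hn => h (Or.inl ⟨A, hA, hn⟩), fun A hA n hn => h (Or.inr ⟨A, hA, hn⟩)⟩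
  · rintro ⟨h₁, h₂⟩ n (⟨A, hA, hn⟩ | ⟨A, hA, hn⟩)
    · exact h₁ A hA hn
    · exact h₂ A hA hn

/-- A set of sequents that is closed under the rules of `mvLKE`, as far as their conclusions have
active parameters in `W`. -/
structure Calculus (W : Set ℕ) (X : Sequent → Prop) : Prop where
  initial : ∀ {S}, S.actives ⊆ W → Initial S → X S
  unary : ∀ {S S'}, S'.actives ⊆ W → Unary S S' → X S → X S'
  binary : ∀ {S₁ S₂ S'}, S'.actives ⊆ W → Binary S₁ S₂ S' → X S₁ → X S₂ → X S'

namespace Calculus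

variable {W : Set ℕ} {X : Sequent → Prop} {Γ Γ' Δ Δ' : Multiset (Formula 0)}

theorem weaken (hX : Calculus W X) (h : X ⟨Γ, Δ⟩)
    (hW : Sequent.actives ⟨Γ' + Γ, Δ' + Δ⟩ ⊆ W) : X ⟨Γ' + Γ, Δ' + Δ⟩ := by
  induction Γ' using Multiset.induction_on with
  | empty =>
    induction Δ' using Multiset.induction_on with
    | empty => simpa using h
    | cons A Δ' ih =>
      simp only [Multiset.cons_add] at hW ⊢
      refine hX.unary hW (.weakR _ _ _) (ih ?_)
      simp_all [Sequent.actives_subset_iff]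
  | cons A Γ' ih =>
    simp only [Multiset.cons_add] at hW ⊢
    refine hX.unary hW (.weakL _ _ _) (ih ?_)
    simp_all [Sequent.actives_subset_iff]

theorem contractL (hX : Calculus W X) (h : X ⟨Γ' + Γ, Δ⟩) (hΓ : Γ' ⊆ Γ)
    (hW : Sequent.actives ⟨Γ, Δ⟩ ⊆ W) : X ⟨Γ, Δ⟩ := by
  induction Γ' using Multiset.induction_on with
  | empty => simpa using h
  | cons A Γ' ih =>
    rw [Multiset.cons_subset] at hΓ
    refine ih ?_ hΓ.2
    obtain ⟨Θ, hΘ⟩ := Multiset.exists_cons_of_mem (Multiset.mem_add.2 (Or.inr hΓ.1) : A ∈ Γ' + Γ)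
    rw [Multiset.cons_add, hΘ] at h
    rw [hΘ]
    refine hX.unary ?_ (.contrL _ _ _) h
    rw [← hΘ]
    rw [Sequent.actives_subset_iff] at hW ⊢
    refine ⟨fun B hB => ?_, hW.2⟩
    rcases Multiset.mem_add.1 hB with hB | hB
    · exact hW.1 B (hΓ.2 hB)
    · exact hW.1 B hB

theorem contractR (hX : Calculus W X) (h : X ⟨Γ, Δ' + Δ⟩) (hΔ : Δ' ⊆ Δ)
    (hW : Sequent.actives ⟨Γ, Δ⟩ ⊆ W) : X ⟨Γ, Δ⟩ := by
  induction Δ' using Multiset.induction_on with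
  | empty => simpa using h
  | cons A Δ' ih =>
    rw [Multiset.cons_subset] at hΔ
    refine ih ?_ hΔ.2
    obtain ⟨Θ, hΘ⟩ := Multiset.exists_cons_of_mem (Multiset.mem_add.2 (Or.inr hΔ.1) : A ∈ Δ' + Δ)
    rw [Multiset.cons_add, hΘ] at h
    rw [hΘ]
    refine hX.unary ?_ (.contrR _ _ _) h
    rw [← hΘ]
    rw [Sequent.actives_subset_iff] at hW ⊢
    refine ⟨hW.1, fun B hB => ?_⟩
    rcases Multiset.mem_add.1 hB with hB | hB
    · exact hW.2 B (hΔ.2 hB)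
    · exact hW.2 B hB

/-- Weaken by the whole larger sequent, then contract the original formulas into it. Multiplicities
and the splitting of contexts can thereby be ignored. -/
theorem mono (hX : Calculus W X) (h : X ⟨Γ, Δ⟩) (hΓ : Γ ⊆ Γ') (hΔ : Δ ⊆ Δ')
    (hW : Sequent.actives ⟨Γ', Δ'⟩ ⊆ W) : X ⟨Γ', Δ'⟩ := by
  have hW' := Sequent.actives_subset_iff.1 hW
  have h₁ : X ⟨Γ' + Γ, Δ' + Δ⟩ := by
    refine hX.weaken h (Sequent.actives_subset_iff.2 ⟨fun A hA => ?_, fun A hA => ?_⟩)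
    · exact hW'.1 A ((Multiset.mem_add.1 hA).elim _root_.id fun h => hΓ h)
    · exact hW'.2 A ((Multiset.mem_add.1 hA).elim _root_.id fun h => hΔ h)
  rw [add_comm Γ', add_comm Δ'] at h₁
  refine hX.contractR (hX.contractL h₁ hΓ ?_) hΔ hW
  refine Sequent.actives_subset_iff.2 ⟨hW'.1, fun A hA => ?_⟩
  exact hW'.2 A ((Multiset.mem_add.1 hA).elim (fun h => hΔ h) _root_.id)

/-- The additive form of the cut rule. -/
theorem cut (hX : Calculus W X) {A : Formula 0} (h₁ : X ⟨Γ, A ::ₘ Δ⟩) (h₂ : X ⟨A ::ₘ Γ, Δ⟩)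
    (hW : Sequent.actives ⟨Γ, Δ⟩ ⊆ W) : X ⟨Γ, Δ⟩ := by
  refine hX.mono (hX.binary ?_ (.cut A Γ Δ Γ Δ) h₁ h₂) ?_ ?_ hW
  · simpa [Sequent.actives_subset_iff] using hW
  · intro B hB; simpa using hB
  · intro B hB; simpa using hB

/-- Simultaneous cuts with all formulas of a sequent. -/
theorem multicut (hX : Calculus W X) (h : X ⟨Γ', Δ'⟩)
    (h₁ : ∀ A ∈ Γ', X ⟨Γ, A ::ₘ Δ⟩) (h₂ : ∀ A ∈ Δ', X ⟨A ::ₘ Γ, Δ⟩)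
    (hW' : Sequent.actives ⟨Γ', Δ'⟩ ⊆ W) (hW : Sequent.actives ⟨Γ, Δ⟩ ⊆ W) : X ⟨Γ, Δ⟩ := by
  have h₀ : X ⟨Γ' + Γ, Δ' + Δ⟩ := by
    refine hX.mono h (Multiset.subset_of_le le_self_add) (Multiset.subset_of_le le_self_add) ?_
    rw [Sequent.actives_subset_iff] at hW hW' ⊢
    simp only [Multiset.mem_add]
    exact ⟨fun A hA => hA.elim (hW'.1 A) (hW.1 A), fun A hA => hA.elim (hW'.2 A) (hW.2 A)⟩
  clear h
  induction Γ' using Multiset.induction_on with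
  | empty =>
    rw [zero_add] at h₀
    induction Δ' using Multiset.induction_on with
    | empty => simpa using h₀
    | cons A Δ' ih =>
      rw [Sequent.actives_subset_iff] at hW hW'
      have hW₀ : Sequent.actives ⟨Γ, Δ' + Δ⟩ ⊆ W := by
        refine Sequent.actives_subset_iff.2 ⟨hW.1, fun B hB => ?_⟩
        exact (Multiset.mem_add.1 hB).elim (fun h => hW'.2 B (Multiset.mem_cons_of_mem h)) (hW.2 B)
      refine ih (fun B hB => h₂ B (Multiset.mem_cons_of_mem hB)) ?_ ?_
      · exact Sequent.actives_subset_iff.2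
          ⟨hW'.1, fun B hB => hW'.2 B (Multiset.mem_cons_of_mem hB)⟩
      · rw [Multiset.cons_add] at h₀
        refine hX.cut h₀ (hX.mono (h₂ A (Multiset.mem_cons_self _ _)) (Multiset.Subset.refl _)
          (Multiset.subset_of_le le_add_self) ?_) hW₀
        rw [Sequent.actives_subset_iff] at hW₀ ⊢
        refine ⟨fun B hB => ?_, hW₀.2⟩
        rcases Multiset.mem_cons.1 hB with rfl | hB
        · exact hW'.2 _ (Multiset.mem_cons_self _ _)
        · exact hW.1 B hB
  | cons A Γ' ih =>
    have hW₁ := Sequent.actives_subset_iff.1 hW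
    have hW₂ := Sequent.actives_subset_iff.1 hW'
    have hW₀ : Sequent.actives ⟨Γ' + Γ, Δ' + Δ⟩ ⊆ W := by
      refine Sequent.actives_subset_iff.2 ⟨fun B hB => ?_, fun B hB => ?_⟩
      · exact (Multiset.mem_add.1 hB).elim (fun h => hW₂.1 B (Multiset.mem_cons_of_mem h)) (hW₁.1 B)
      · exact (Multiset.mem_add.1 hB).elim (hW₂.2 B) (hW₁.2 B)
    refine ih (fun B hB => h₁ B (Multiset.mem_cons_of_mem hB)) ?_ ?_
    · exact Sequent.actives_subset_iff.2 ⟨fun B hB => hW₂.1 B (Multiset.mem_cons_of_mem hB), hW₂.2⟩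
    · rw [Multiset.cons_add] at h₀
      refine hX.cut (hX.mono (h₁ A (Multiset.mem_cons_self _ _))
        (Multiset.subset_of_le le_add_self) ?_ ?_) h₀ hW₀
      · exact Multiset.cons_subset_cons (Multiset.subset_of_le le_add_self)
      rw [Sequent.actives_subset_iff] at hW₀ ⊢
      refine ⟨hW₀.1, fun B hB => ?_⟩
      rcases Multiset.mem_cons.1 hB with rfl | hB
      · exact hW₂.1 _ (Multiset.mem_cons_self _ _)
      · exact hW₀.2 B hB

end Calculus

/-! ### Equational reasoning -/

theorem Formula.actives_subst {k m : ℕ} {A : Formula k} {σ : Subst k m} {n : ℕ}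
    (h : n ∈ (A.subst σ).actives) :
    (∃ i, .active n ∈ (σ.bvar i).params) ∨ ∃ q ∈ A.params, .active n ∈ (σ.param q).params :=
  Formula.mem_params_subst h

/-- The extension of a substitution by a term for the innermost bound variable. -/
def Subst.cons {k : ℕ} (t : Term 0) (σ : Subst k 0) : Subst (k + 1) 0 :=
  ⟨Fin.cases t σ.bvar, σ.param⟩

namespace Calculus

variable {W : Set ℕ} {X : Sequent → Prop} {E Γ : Multiset (Formula 0)}

/-- Cutting against the antecedent turns an initial sequent into an inference rule in context `E`;
the equality axioms become the congruence rules below. -/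
theorem of_initial (hX : Calculus W X) {C : Formula 0} (h : Initial ⟨Γ, {C}⟩)
    (hΓ : ∀ A ∈ Γ, A.actives ⊆ W) (hC : C.actives ⊆ W) (hE : ∀ A ∈ E, A.actives ⊆ W)
    (hd : ∀ A ∈ Γ, X ⟨E, {A}⟩) : X ⟨E, {C}⟩ := by
  have hW : Sequent.actives ⟨Γ, {C}⟩ ⊆ W :=
    Sequent.actives_subset_iff.2 ⟨hΓ, by simpa using hC⟩
  have hCC : Sequent.actives ⟨{C}, {C}⟩ ⊆ W :=
    Sequent.actives_subset_iff.2 ⟨by simpa using hC, by simpa using hC⟩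
  refine hX.multicut (hX.initial hW h) (fun A hA => ?_) (fun A hA => ?_) hW ?_
  · refine hX.mono (hd A hA) (Multiset.Subset.refl _) (by intro; simp; tauto) ?_
    refine Sequent.actives_subset_iff.2 ⟨hE, ?_⟩
    simp [hC, hΓ A hA]
  · obtain rfl := Multiset.mem_singleton.1 hA
    refine hX.mono (hX.initial hCC (.id _)) (by intro; simp; tauto) (Multiset.Subset.refl _) ?_
    refine Sequent.actives_subset_iff.2 ⟨?_, by simpa using hC⟩
    simpa [hC] using hE
  · exact Sequent.actives_subset_iff.2 ⟨hE, by simpa using hC⟩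

/-- Derivable equality of terms in the context `E`. -/
def EqMod (W : Set ℕ) (X : Sequent → Prop) (E : Multiset (Formula 0)) (s t : Term 0) : Prop :=
  (Formula.eq s t).actives ⊆ W ∧ X ⟨E, {.eq s t}⟩

theorem EqMod.weaken (hX : Calculus W X) {s t : Term 0} (h : EqMod W X E s t) {A : Formula 0}
    (hA : A.actives ⊆ W) (hE : ∀ A ∈ E, A.actives ⊆ W) : EqMod W X (A ::ₘ E) s t := by
  refine ⟨h.1, hX.mono h.2 (Multiset.subset_cons _ _) (Multiset.Subset.refl _) ?_⟩
  refine Sequent.actives_subset_iff.2 ⟨?_, by simpa using h.1⟩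
  simpa [hA] using hE

section

variable (hX : Calculus W X) (hE : ∀ A ∈ E, A.actives ⊆ W)
include hX hE

theorem EqMod.refl {t : Term 0} (ht : ∀ n, .active n ∈ t.params → n ∈ W) : EqMod W X E t t := by
  have : (Formula.eq t t).actives ⊆ W := fun n hn => hn.elim (ht n) (ht n)
  exact ⟨this, hX.of_initial (.eq_refl t) (by simp) this hE (by simp)⟩

theorem EqMod.symm {s t : Term 0} (h : EqMod W X E s t) : EqMod W X E t s := by
  have hs : EqMod W X E s s := EqMod.refl hX hE fun n hn => h.1 (Or.inl hn)
  have hts : (Formula.eq t s).actives ⊆ W := fun n hn => h.1 hn.symm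
  -- The axiom reads `s = t, s = s, s = s ⊢ t = s`.
  refine ⟨hts, hX.of_initial (.eq_eq s t s s) ?_ hts hE ?_⟩
  · simp [h.1, hs.1]
  · simp [h.2, hs.2]

theorem EqMod.succ {s t : Term 0} (h : EqMod W X E s t) : EqMod W X E s.succ t.succ := by
  have : (Formula.eq s.succ t.succ).actives ⊆ W := h.1
  exact ⟨this, hX.of_initial (.eq_succ s t) (by simpa using h.1) this hE (by simpa using h.2)⟩

theorem EqMod.add {s s' t t' : Term 0} (h : EqMod W X E s s') (h' : EqMod W X E t t') :
    EqMod W X E (s.add t) (s'.add t') := by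
  have : (Formula.eq (s.add t) (s'.add t')).actives ⊆ W := by
    rintro n ((hn | hn) | (hn | hn))
    exacts [h.1 (Or.inl hn), h'.1 (Or.inl hn), h.1 (Or.inr hn), h'.1 (Or.inr hn)]
  refine ⟨this, hX.of_initial (.eq_add s s' t t') ?_ this hE ?_⟩
  · simp [h.1, h'.1]
  · simp [h.2, h'.2]

theorem EqMod.mul {s s' t t' : Term 0} (h : EqMod W X E s s') (h' : EqMod W X E t t') :
    EqMod W X E (s.mul t) (s'.mul t') := by
  have : (Formula.eq (s.mul t) (s'.mul t')).actives ⊆ W := by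
    rintro n ((hn | hn) | (hn | hn))
    exacts [h.1 (Or.inl hn), h'.1 (Or.inl hn), h.1 (Or.inr hn), h'.1 (Or.inr hn)]
  refine ⟨this, hX.of_initial (.eq_mul s s' t t') ?_ this hE ?_⟩
  · simp [h.1, h'.1]
  · simp [h.2, h'.2]

end

/-- Two substitutions are derivably equal on all bound variables and on the parameters in `P`. -/
def SubstEq (W : Set ℕ) (X : Sequent → Prop) (E : Multiset (Formula 0)) {k : ℕ} (P : Set Param)
    (σ τ : Subst k 0) : Prop :=
  (∀ i, EqMod W X E (σ.bvar i) (τ.bvar i)) ∧ ∀ p ∈ P, EqMod W X E (σ.param p) (τ.param p)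

theorem SubstEq.subset {k : ℕ} {P Q : Set Param} {σ τ : Subst k 0} (h : SubstEq W X E P σ τ)
    (hQ : Q ⊆ P) : SubstEq W X E Q σ τ := ⟨h.1, fun p hp => h.2 p (hQ hp)⟩

theorem SubstEq.actives {k : ℕ} {A : Formula k} {σ τ : Subst k 0}
    (h : SubstEq W X E A.params σ τ) : (A.subst σ).actives ⊆ W := by
  intro n hn
  rcases Formula.actives_subst hn with ⟨i, hi⟩ | ⟨q, hq, hn⟩
  · exact (h.1 i).1 (Or.inl hi)
  · exact (h.2 q hq).1 (Or.inl hn)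

theorem SubstEq.symm (hX : Calculus W X) (hE : ∀ A ∈ E, A.actives ⊆ W) {k : ℕ} {P : Set Param}
    {σ τ : Subst k 0} (h : SubstEq W X E P σ τ) : SubstEq W X E P τ σ :=
  ⟨fun i => (h.1 i).symm hX hE, fun p hp => (h.2 p hp).symm hX hE⟩

theorem SubstEq.cons (hX : Calculus W X) (hE : ∀ A ∈ E, A.actives ⊆ W) {k : ℕ} {P : Set Param}
    {σ τ : Subst k 0} (h : SubstEq W X E P σ τ) (γ : ℕ) :
    SubstEq W X E P (σ.cons (.param (.passive γ))) (τ.cons (.param (.passive γ))) := by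
  refine ⟨fun i => Fin.cases ?_ (fun i => h.1 i) i, h.2⟩
  exact EqMod.refl hX hE fun n hn => by cases hn

theorem eqMod_subst (hX : Calculus W X) (hE : ∀ A ∈ E, A.actives ⊆ W) {k : ℕ} (t : Term k)
    {σ τ : Subst k 0} (h : SubstEq W X E t.params σ τ) :
    EqMod W X E (t.subst σ) (t.subst τ) := by
  induction t with
  | bvar i => exact h.1 i
  | param p => exact h.2 p rfl
  | zero => exact EqMod.refl hX hE fun n hn => hn.elim
  | succ t ih => exact (ih h).succ hX hE
  | add s t ihs iht =>
    exact (ihs (h.subset Set.subset_union_left)).add hX hE (iht (h.subset Set.subset_union_right))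
  | mul s t ihs iht =>
    exact (ihs (h.subset Set.subset_union_left)).mul hX hE (iht (h.subset Set.subset_union_right))

theorem quantifiable_passive (α : ℕ) : (Term.param (.passive α) : Term 0).Quantifiable :=
  fun _ hp => ⟨α, hp⟩

theorem exists_fresh (S : Sequent) : ∃ α, Param.passive α ∉ S.params := by
  obtain ⟨N, hN⟩ := exists_passive_bound S.params_finite
  exact ⟨N, fun h => lt_irrefl _ (hN N h)⟩

/-- Replacement of derivably equal terms in a formula. -/
theorem subst_eq (hX : Calculus W X) (hE : ∀ A ∈ E, A.actives ⊆ W) {k : ℕ} (A : Formula k) :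
    ∀ {σ τ : Subst k 0}, SubstEq W X E A.params σ τ → X ⟨A.subst σ ::ₘ E, {A.subst τ}⟩ := by
  have ok : ∀ {A B : Formula 0}, A.actives ⊆ W → B.actives ⊆ W →
      Sequent.actives ⟨A ::ₘ E, {B}⟩ ⊆ W := fun {A B} hA hB =>
    Sequent.actives_subset_iff.2 ⟨by simpa [hA] using hE, by simpa using hB⟩
  induction A with
  | eq s t =>
    intro σ τ h
    have hA := h.actives
    have hB := (h.symm hX hE).actives
    have hs := EqMod.weaken hX (eqMod_subst hX hE s (h.subset Set.subset_union_left)) hA hE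
    have ht := EqMod.weaken hX (eqMod_subst hX hE t (h.subset Set.subset_union_right)) hA hE
    have hst : X ⟨(Formula.eq s t).subst σ ::ₘ E, {(Formula.eq s t).subst σ}⟩ := by
      refine hX.mono (hX.initial ?_ (.id ((Formula.eq s t).subst σ))) (by simp)
        (Multiset.Subset.refl _) (ok hA hA)
      exact Sequent.actives_subset_iff.2 ⟨by simpa using hA, by simpa using hA⟩
    refine hX.of_initial (.eq_eq (s.subst σ) (s.subst τ) (t.subst σ) (t.subst τ)) ?_ hB ?_ ?_
    · have : (Formula.eq (s.subst σ) (t.subst σ)).actives ⊆ W := hA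
      simp [hs.1, ht.1, this]
    · simpa [hA] using hE
    · have : X ⟨(Formula.eq s t).subst σ ::ₘ E, {Formula.eq (s.subst σ) (t.subst σ)}⟩ := hst
      simp [hs.2, ht.2, this]
  | neg A ih =>
    intro σ τ h
    have hA : (A.neg.subst σ).actives ⊆ W := h.actives
    have hB : (A.neg.subst τ).actives ⊆ W := (h.symm hX hE).actives
    have h₁ := ih (h.symm hX hE)
    refine hX.unary (ok hA hB) (.negR (A.subst τ) (A.neg.subst σ ::ₘ E) 0) ?_
    rw [Multiset.cons_swap]
    refine hX.unary ?_ (.negL (A.subst σ) (A.subst τ ::ₘ E) 0) h₁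
    have hB' : (A.subst τ).actives ⊆ W := hB
    exact Sequent.actives_subset_iff.2
      ⟨Multiset.forall_mem_cons.2 ⟨hA, Multiset.forall_mem_cons.2 ⟨hB', hE⟩⟩, by simp⟩
  | and A B ihA ihB =>
    intro σ τ h
    have h₁ := h.actives
    have h₂ := (h.symm hX hE).actives
    have hA := h.subset (Q := A.params) Set.subset_union_left
    have hB := h.subset (Q := B.params) Set.subset_union_right
    refine hX.binary (ok h₁ h₂) (.andR (A.subst τ) (B.subst τ) _ 0) ?_ ?_
    · exact hX.unary (ok h₁ (hA.symm hX hE).actives) (.andL₁ (A.subst σ) (B.subst σ) _ _) (ihA hA)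
    · exact hX.unary (ok h₁ (hB.symm hX hE).actives) (.andL₂ (A.subst σ) (B.subst σ) _ _) (ihB hB)
  | or A B ihA ihB =>
    intro σ τ h
    have h₁ := h.actives
    have h₂ := (h.symm hX hE).actives
    have hA := h.subset (Q := A.params) Set.subset_union_left
    have hB := h.subset (Q := B.params) Set.subset_union_right
    refine hX.binary (ok h₁ h₂) (.orL (A.subst σ) (B.subst σ) _ _) ?_ ?_
    · exact hX.unary (ok hA.actives h₂) (.orR₁ (A.subst τ) (B.subst τ) _ 0) (ihA hA)
    · exact hX.unary (ok hB.actives h₂) (.orR₂ (A.subst τ) (B.subst τ) _ 0) (ihB hB)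
  | imp A B ihA ihB =>
    intro σ τ h
    have h₁ := h.actives
    have h₂ := (h.symm hX hE).actives
    have hA := h.subset (Q := A.params) Set.subset_union_left
    have hB := h.subset (Q := B.params) Set.subset_union_right
    have hAτ := (hA.symm hX hE).actives
    have hBτ := (hB.symm hX hE).actives
    have h₁' : ((A.subst σ).imp (B.subst σ)).actives ⊆ W := h₁
    refine hX.unary (ok h₁ h₂) (.impR (A.subst τ) (B.subst τ) _ 0) ?_
    -- The multiplicative rule duplicates `E`; `mono` contracts it again.
    refine hX.mono (hX.binary ?_ (.impL (A.subst σ) (B.subst σ) (A.subst τ ::ₘ E) 0 E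
      {B.subst τ}) (ihA (hA.symm hX hE)) (ihB hB)) ?_ ?_ ?_
    · refine Sequent.actives_subset_iff.2 ⟨?_, by simpa using hBτ⟩
      simpa [h₁', hAτ] using hE
    · intro; simp [Formula.subst]; tauto
    · intro; simp
    · refine Sequent.actives_subset_iff.2 ⟨?_, by simpa using hBτ⟩
      simpa [h₁, hAτ] using hE
  | all A ih =>
    intro σ τ h
    have h₁ := h.actives
    have h₂ := (h.symm hX hE).actives
    -- A fresh passive `γ` stands for the bound variable on both sides, so the induction hypothesis
    -- only ever concerns closed instances. Being passive, `γ` serves both as eigenvariable and as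
    -- quantifiable term.
    obtain ⟨γ, hγ⟩ := exists_fresh ⟨A.all.subst σ ::ₘ E, {A.all.subst τ}⟩
    have hc := h.cons hX hE γ
    have h₃ := ih hc
    have h₄ := (hc.symm hX hE).actives (A := A)
    simp only [Subst.cons, ← Formula.subst_lift_inst] at h₃ h₄
    refine hX.unary (ok h₁ h₂) (.allR _ γ _ 0 hγ) ?_
    exact hX.unary (ok h₁ h₄) (.allL _ _ _ _ (quantifiable_passive γ)) h₃
  | ex A ih =>
    intro σ τ h
    have h₁ := h.actives
    have h₂ := (h.symm hX hE).actives
    obtain ⟨γ, hγ⟩ := exists_fresh ⟨A.ex.subst σ ::ₘ E, {A.ex.subst τ}⟩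
    have hc := h.cons hX hE γ
    have h₃ := ih hc
    have h₄ := hc.actives (A := A)
    simp only [Subst.cons, ← Formula.subst_lift_inst] at h₃ h₄
    refine hX.unary (ok h₁ h₂) (.exL _ γ _ _ hγ) ?_
    exact hX.unary (ok h₄ h₂) (.exR _ _ _ 0 (quantifiable_passive γ)) h₃

end Calculus

/-! ### Instances of derivable sequents -/

theorem mvLKIE_calculus (k : ℕ) : Calculus {k} fun S => Nonempty (MvLKIE S) where
  initial hS h := ⟨.initial (Set.subsingleton_singleton.anti hS) h⟩
  unary hS h := fun ⟨d⟩ => ⟨.unary (Set.subsingleton_singleton.anti hS) h d⟩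
  binary hS h := fun ⟨d₁⟩ ⟨d₂⟩ => ⟨.binary (Set.subsingleton_singleton.anti hS) h d₁ d₂⟩

theorem Derivation.atMostOneActive {Leaf : Sequent → Type} {Rule : Sequent → Sequent → Prop}
    {S : Sequent} (d : Derivation Leaf Rule S) : S.AtMostOneActive := by
  cases d <;> assumption

theorem exists_actives_param (q : Param) : ∃ k, ∀ n, .active n = q → n = k := by
  cases q with
  | active k => exact ⟨k, fun n h => by cases h; rfl⟩
  | passive k => exact ⟨0, fun n h => by cases h⟩
  | internal k => exact ⟨0, fun n h => by cases h⟩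

/-- Every parameter is equal to some element of the range of the quantifiers. -/
theorem mvLKIE_exists_eq (q : Param) :
    Nonempty (MvLKIE ⟨0, {.ex (.eq (.bvar 0) (.param q))}⟩) := by
  have ok : ∀ {Γ Δ : Multiset (Formula 0)} {n : ℕ}, (∀ A ∈ Γ, A.actives ⊆ {n}) →
      (∀ A ∈ Δ, A.actives ⊆ {n}) → Sequent.AtMostOneActive ⟨Γ, Δ⟩ := fun h₁ h₂ =>
    Set.subsingleton_singleton.anti (Sequent.actives_subset_iff.2 ⟨h₁, h₂⟩)
  let F : Formula 0 := .ex (.eq (.bvar 0) (.param (.active 0)))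
  let G : Formula 0 := .ex (.eq (.bvar 0) (.succ (.param (.active 0))))
  let H : Formula 0 := .ex (.eq (.bvar 0) .zero)
  let Q : Formula 0 := .ex (.eq (.bvar 0) (.param q))
  have hF : F.actives ⊆ {0} := by
    simp [F, Formula.actives, Formula.params, Term.params]
  have hG : G.actives ⊆ {0} := by
    simp [G, Formula.actives, Formula.params, Term.params]
  have hH : ∀ n, H.actives ⊆ {n} := by
    simp [H, Formula.actives, Formula.params, Term.params]
  obtain ⟨k, hk⟩ := exists_actives_param q
  have hQ : Q.actives ⊆ {k} := by
    intro n hn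
    exact hk n (by simpa [Q, Formula.actives, Formula.params, Term.params] using hn)
  let a : Term 0 := .param (.passive 0)
  let n : Term 0 := .param (.active 0)
  have haF : (Formula.eq a n).actives ⊆ {0} := by
    simp [a, n, Formula.actives, Formula.params, Term.params]
  have hsF : (Formula.eq a.succ n.succ).actives ⊆ {0} := by
    simp [a, n, Formula.actives, Formula.params, Term.params]
  have d₁ : MvLKIE ⟨{.eq a n}, {.eq a.succ n.succ}⟩ :=
    .initial (ok (n := 0) (by simpa using haF) (by simpa using hsF)) (.eq_succ _ _)
  have d₂ : MvLKIE ⟨{.eq a n}, {G}⟩ :=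
    .unary (ok (n := 0) (by simpa using haF) (by simpa using hG))
      (.exR (.eq (.bvar 0) (.succ (.param (.active 0)))) a.succ _ 0
        (Calculus.quantifiable_passive 0)) d₁
  have d₃ : MvLKIE ⟨{F}, {G}⟩ := by
    refine .unary (ok (n := 0) (by simpa using hF) (by simpa using hG))
      (.exL (.eq (.bvar 0) (.param (.active 0))) 0 0 _ ?_) d₂
    simp [Sequent.params, Formula.params, Term.params, G]
  -- Here `q` enters as the arbitrary term in the conclusion of the induction rule, not as the
  -- witness of a quantifier rule. This evades the ban on quantifying active and internal
  -- parameters.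
  have d₄ : MvLKIE ⟨{H}, {Q}⟩ := by
    refine .rule (ok (n := k) (by simpa using hH k) (by simpa using hQ))
      (.mk F 0 ∅ (.param q) (fun _ => .zero) 0 0 ?_ ?_) d₃
    all_goals simp [Sequent.params]
  have d₅ : MvLKIE ⟨0, {.eq .zero .zero}⟩ :=
    .initial (ok (n := 0) (by simp) (by simp [Formula.actives, Formula.params, Term.params]))
      (.eq_refl _)
  have d₆ : MvLKIE ⟨0, {H}⟩ :=
    .unary (ok (n := 0) (by simp) (by simpa using hH 0))
      (.exR (.eq (.bvar 0) .zero) .zero _ 0 fun p hp => hp.elim) d₅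
  exact ⟨.binary (ok (n := k) (by simp) (by simpa using hQ)) (.cut H 0 0 0 {Q}) d₆ d₄⟩

open Classical in
/-- The substitution of a term for a single parameter. -/
noncomputable def Subst.single (p : Param) (t : Term 0) : Subst 0 0 :=
  ⟨Term.bvar, fun q => if q = p then t else .param q⟩

theorem Subst.single_self (p : Param) (t : Term 0) : (Subst.single p t).param p = t := by
  simp [Subst.single]

theorem Subst.single_of_ne {p q : Param} (t : Term 0) (h : q ≠ p) :
    (Subst.single p t).param q = .param q := by
  simp [Subst.single, h]

/-- Arbitrary parameters may be substituted for passive ones in sequents without active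
parameters. -/
theorem mvLKIE_subst_single {S : Sequent} (hS : S.actives = ∅) (h : Nonempty (MvLKIE S))
    {β : ℕ} {q : Param} (hq : q ≠ .passive β) :
    Nonempty (MvLKIE (S.subst (Subst.single (.passive β) (.param q)))) := by
  -- Since `S` has no active parameter, `q` is the only possible source of one, and `{k}` bounds all
  -- sequents below.
  obtain ⟨k, hk⟩ := exists_actives_param q
  have hX := mvLKIE_calculus k
  set σ := Subst.single (.passive β) (.param q) with hσ
  -- Under the hypothesis `e`, replacement of equals leads from `S` to its instance. There `β` no
  -- longer occurs, so it can be bound in `e` by `∃`-left, and `∃ x, x = q` is cut away.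
  set e : Formula 0 := .eq (.param (.passive β)) (.param q) with he
  have heW : e.actives ⊆ {k} := by
    intro n hn
    exact hk n (by simpa [e, Formula.actives, Formula.params, Term.params] using hn)
  have hE : ∀ A ∈ ({e} : Multiset (Formula 0)), A.actives ⊆ {k} := by simpa using heW
  have heq : Calculus.EqMod {k} (fun S => Nonempty (MvLKIE S)) {e}
      (.param (.passive β)) (.param q) :=
    ⟨heW, hX.initial (Sequent.actives_subset_iff.2 ⟨hE, hE⟩) (.id e)⟩
  have hact : ∀ A : Formula 0, A.actives ⊆ S.actives → Calculus.SubstEq {k}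
      (fun S => Nonempty (MvLKIE S)) {e} A.params (Subst.id 0) σ := by
    intro A hA
    refine ⟨fun i => i.elim0, fun p hp => ?_⟩
    by_cases hpβ : p = .passive β
    · subst hpβ
      rw [hσ, Subst.single_self]
      exact heq
    · rw [hσ, Subst.single_of_ne _ hpβ]
      refine Calculus.EqMod.refl hX hE fun n hn => ?_
      have hnp : Param.active n = p := hn
      have : n ∈ S.actives := hA (show Param.active n ∈ A.params from hnp ▸ hp)
      simp [hS] at this
  have hanteS : ∀ A ∈ S.ante, A.actives ⊆ S.actives := fun A hA n hn => Or.inl ⟨A, hA, hn⟩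
  have hsuccS : ∀ A ∈ S.succ, A.actives ⊆ S.actives := fun A hA n hn => Or.inr ⟨A, hA, hn⟩
  have hSk : S.actives ⊆ {k} := by simp [hS]
  have hSσ : (S.subst σ).actives ⊆ {k} := by
    refine Sequent.actives_subset_iff.2 ⟨fun B hB => ?_, fun B hB => ?_⟩
    · obtain ⟨A, hA, rfl⟩ := Multiset.mem_map.1 hB
      exact ((hact A (hanteS A hA)).symm hX hE).actives
    · obtain ⟨A, hA, rfl⟩ := Multiset.mem_map.1 hB
      exact ((hact A (hsuccS A hA)).symm hX hE).actives
  have hSσ' := Sequent.actives_subset_iff.1 hSσ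
  have hESσ : Sequent.actives ⟨e ::ₘ (S.subst σ).ante, (S.subst σ).succ⟩ ⊆ {k} := by
    exact Sequent.actives_subset_iff.2 ⟨Multiset.forall_mem_cons.2 ⟨heW, hSσ'.1⟩, hSσ'.2⟩
  have hcut : Nonempty (MvLKIE ⟨e ::ₘ (S.subst σ).ante, (S.subst σ).succ⟩) := by
    refine hX.multicut (Γ' := S.ante) (Δ' := S.succ) h (fun A hA => ?_) (fun A hA => ?_) hSk hESσ
    · have h₁ := hX.subst_eq hE A ((hact A (hanteS A hA)).symm hX hE)
      rw [Formula.subst_id] at h₁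
      refine hX.mono h₁ ?_ (by simp) ?_
      · have : A.subst σ ∈ (S.subst σ).ante := Multiset.mem_map_of_mem _ hA
        intro B; simp only [Multiset.mem_cons, Multiset.mem_singleton]
        rintro (rfl | rfl)
        exacts [Or.inr this, Or.inl rfl]
      · refine Sequent.actives_subset_iff.2 ⟨(Sequent.actives_subset_iff.1 hESσ).1, ?_⟩
        exact Multiset.forall_mem_cons.2 ⟨(hanteS A hA).trans hSk, hSσ'.2⟩
    · have h₁ := hX.subst_eq hE A (hact A (hsuccS A hA))
      rw [Formula.subst_id] at h₁
      refine hX.mono h₁ ?_ ?_ ?_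
      · intro B; simp only [Multiset.mem_cons, Multiset.mem_singleton]
        tauto
      · exact Multiset.singleton_subset.2 (Multiset.mem_map_of_mem _ hA)
      · refine Sequent.actives_subset_iff.2 ⟨?_, hSσ'.2⟩
        exact Multiset.forall_mem_cons.2 ⟨(hsuccS A hA).trans hSk,
          Multiset.forall_mem_cons.2 ⟨heW, hSσ'.1⟩⟩
  have hex : Nonempty (MvLKIE ⟨.ex (.eq (.bvar 0) (.param q)) ::ₘ (S.subst σ).ante,
      (S.subst σ).succ⟩) := by
    refine hX.unary ?_ (.exL _ β _ _ ?_) hcut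
    · refine Sequent.actives_subset_iff.2 ⟨?_, hSσ'.2⟩
      have : (Formula.ex (.eq (.bvar 0) (.param q)) : Formula 0).actives ⊆ {k} := by
        intro n hn
        exact hk n (by simpa [Formula.actives, Formula.params, Term.params] using hn)
      exact Multiset.forall_mem_cons.2 ⟨this, hSσ'.1⟩
    · have h₁ : Param.passive β ∉ (S.subst σ).params := by
        rw [Sequent.mem_params_subst]
        rintro ⟨p, -, hp⟩
        by_cases hpβ : p = .passive β
        · subst hpβ
          rw [hσ, Subst.single_self] at hp
          exact hq hp.symm
        · rw [hσ, Subst.single_of_ne _ hpβ] at hp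
          exact hpβ hp.symm
      rintro (⟨B, hB, hp⟩ | hp)
      · rcases Multiset.mem_cons.1 hB with rfl | hB
        · have : Param.passive β = q := by
            simpa [Formula.params, Term.params] using hp
          exact hq this.symm
        · exact h₁ (Or.inl ⟨B, hB, hp⟩)
      · exact h₁ (Or.inr hp)
  have := hX.binary ?_ (.cut _ 0 0 _ _) (mvLKIE_exists_eq q) hex
  · simpa using this
  · simpa using hSσ

/-! ### Uniform derivability -/

/-- All instances of `S` by quantifiable terms are derivable in `mvLKIE`. -/
def Uniform (S : Sequent) : Prop :=
  ∀ τ : Subst 0 0, (∀ p, (τ.param p).Quantifiable) → Nonempty (MvLKIE (S.subst τ))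

theorem Sequent.actives_subst_eq_empty (S : Sequent) {τ : Subst 0 0}
    (hτ : ∀ p, (τ.param p).Quantifiable) : (S.subst τ).actives = ∅ := by
  refine Set.eq_empty_of_forall_notMem fun n hn => ?_
  obtain ⟨q, -, hq⟩ := Sequent.mem_params_subst.1 hn
  obtain ⟨α, hα⟩ := hτ q _ hq
  cases hα

/-- An arbitrary substitution followed by a quantifiable one is quantifiable. This is what lets a
link take any terms as arguments. -/
theorem Uniform.subst {S : Sequent} (h : Uniform S) (σ : Subst 0 0) : Uniform (S.subst σ) := by
  intro τ hτ
  rw [Sequent.subst_subst]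
  exact h _ fun p => Term.Quantifiable.subst_of_forall _ hτ

-- The substitution `τ` may capture an eigenvariable, so it is altered outside the parameters of the
-- conclusion: there passive parameters are shifted beyond `N`, hence past everything in the
-- instance, and the conclusion is unaffected.
open Classical in
theorem Uniform.unary {S S' : Sequent} (h : Unary S S') (hS : Uniform S) : Uniform S' := by
  intro τ hτ
  obtain ⟨N, hN⟩ := exists_passive_bound (S'.subst τ).params_finite
  let τ' : Subst 0 0 := ⟨Term.bvar, fun p => if p ∈ S'.params then τ.param p else
    match p with
    | .passive α => .param (.passive (N + α))
    | _ => .zero⟩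
  have hτ' : ∀ p, (τ'.param p).Quantifiable := by
    intro p
    by_cases hp : p ∈ S'.params
    · simpa [τ', hp] using hτ p
    · simp only [τ', hp, if_false]
      split
      · exact Calculus.quantifiable_passive _
      · exact fun p hp => hp.elim
  have heq : S'.subst τ' = S'.subst τ := Sequent.subst_congr fun p hp => by simp [τ', hp]
  have hu : Unary (S.subst τ') (S'.subst τ') := by
    refine h.subst (fun α => hτ' _) fun α hα => ⟨N + α, by simp [τ', hα], fun q hq hmem => ?_⟩
    have hq' : τ'.param q = τ.param q := by simp [τ', hq]
    rw [hq'] at hmem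
    have := hN _ (Sequent.mem_params_subst.2 ⟨q, hq, hmem⟩)
    omega
  rw [← heq]
  exact (mvLKIE_calculus 0).unary (by simp [Sequent.actives_subst_eq_empty S' hτ']) hu (hS τ' hτ')

/-- The relevant instances contain no active parameter at all, so no bound on active parameters is
needed. -/
theorem uniform_calculus : Calculus Set.univ Uniform where
  initial _ h τ hτ := (mvLKIE_calculus 0).initial
    (by simp [Sequent.actives_subst_eq_empty _ hτ]) (h.subst τ)
  unary _ h hS := hS.unary h
  binary _ h h₁ h₂ τ hτ := (mvLKIE_calculus 0).binary
    (by simp [Sequent.actives_subst_eq_empty _ hτ]) (h.subst τ) (h₁ τ hτ) (h₂ τ hτ)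

theorem Uniform.allL {A : Formula 1} (t : Term 0) {Γ Δ : Multiset (Formula 0)}
    (h : Uniform ⟨A.inst t ::ₘ Γ, Δ⟩) : Uniform ⟨.all A ::ₘ Γ, Δ⟩ := by
  intro τ hτ
  refine (mvLKIE_calculus 0).unary (by simp [Sequent.actives_subst_eq_empty _ hτ]) ?_ (h τ hτ)
  simp only [Sequent.subst, Multiset.map_cons, Formula.inst_subst, Formula.subst]
  exact .allL _ _ _ _ (Term.Quantifiable.subst_of_forall t hτ)

-- Uniformity supplies the induction step only at passive values of `n`. A fresh passive parameter
-- is used and then traded for an active one, after which the induction rule applies with the value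
-- of `n` under `τ` as its term.
open Classical in
theorem Uniform.induction {F : Formula 0} {n : ℕ}
    (h₀ : Uniform ⟨0, {F.subst (substActive n .zero)}⟩)
    (h₁ : Uniform ⟨{F}, {F.subst (substActive n (.succ (.param (.active n))))}⟩) :
    Uniform ⟨0, {F}⟩ := by
  intro τ hτ
  by_cases hn : .active n ∈ F.params
  swap
  · have := h₀ τ hτ
    rwa [F.subst_eq_self] at this
    rintro (j | j | j) hp <;> simp only [substActive]
    rw [if_neg]
    rintro rfl
    exact hn hp
  obtain ⟨N, hN⟩ := exists_passive_bound (F.subst τ).params_finite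
  have hfresh : ∀ q ∈ F.params, ∀ p ∈ (τ.param q).params, p ≠ .passive N := by
    rintro q hq p hp rfl
    exact lt_irrefl _ (hN _ (Formula.params_subst_of_mem hq hp))
  -- The substitution `τ` with its value at `n` changed to `u`; `F.subst (upd u)` plays the part of
  -- `F(u)`.
  let upd : Term 0 → Subst 0 0 := fun u =>
    ⟨Term.bvar, fun p => if p = .active n then u else τ.param p⟩
  have hupd : ∀ (u v : Term 0) (σ σ' : Subst 0 0), u.subst σ = v.subst σ' →
      (∀ q ∈ F.params, (τ.param q).subst σ = (τ.param q).subst σ') →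
      (F.subst (upd u)).subst σ = (F.subst (upd v)).subst σ' := by
    intro u v σ σ' huv hq
    rw [Formula.subst_subst, Formula.subst_subst]
    refine F.subst_congr (fun i => i.elim0) fun p hp => ?_
    by_cases hpn : p = .active n
    · simpa [upd, Subst.comp, hpn] using huv
    · simpa [upd, Subst.comp, hpn] using hq p hp
  have hself : upd (τ.param (.active n)) = τ := by
    refine Subst.ext' (fun i => i.elim0) fun p => ?_
    by_cases hpn : p = .active n <;> simp [upd, hpn]
  have hsub : ∀ t u : Term 0, (F.subst (substActive n t)).subst (upd u) =
      F.subst (upd (t.subst (upd u))) := by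
    intro t u
    rw [Formula.subst_subst]
    refine F.subst_congr (fun i => i.elim0) ?_
    rintro (j | j | j) hp
    · by_cases hj : j = n <;> simp [upd, Subst.comp, substActive, hj, Term.subst]
    · simp [upd, Subst.comp, substActive, Term.subst]
    · simp [upd, Subst.comp, substActive, Term.subst]
  let a : Term 0 := .param (.active 0)
  let G : Formula 0 := F.subst (upd a)
  have hfix : ∀ (σ : Subst 0 0), (∀ α, σ.param (.passive α) = .param (.passive α)) →
      ∀ q, (τ.param q).subst σ = τ.param q := by
    intro σ hσ q
    refine Term.subst_eq_self _ fun p hp => ?_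
    obtain ⟨α, rfl⟩ := hτ q p hp
    exact hσ α
  -- The induction step at the fresh passive `N`, with `N` then replaced by the active parameter
  -- `0`. The other values of `τ` avoid `N` on `F` and stay unchanged.
  have hstep : Nonempty (MvLKIE ⟨{G}, {G.subst (substActive 0 (.succ a))}⟩) := by
    have hτN : ∀ p, ((upd (.param (.passive N))).param p).Quantifiable := by
      intro p
      by_cases hpn : p = .active n
      · simpa [upd, hpn] using Calculus.quantifiable_passive N
      · simpa [upd, hpn] using hτ p
    have := mvLKIE_subst_single (Sequent.actives_subst_eq_empty _ hτN) (h₁ _ hτN) (β := N)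
      (q := .active 0) (by simp)
    convert this using 2
    have hs : ∀ q ∈ F.params,
        (τ.param q).subst (Subst.single (.passive N) (.param (.active 0))) = τ.param q :=
      fun q hq => Term.subst_eq_self _ fun p hp => Subst.single_of_ne _ (hfresh q hq p hp)
    simp only [Sequent.subst, Multiset.map_singleton, Sequent.mk.injEq, Multiset.singleton_inj]
    constructor
    · rw [← Formula.subst_id G]
      refine hupd _ _ _ _ ?_ fun q hq => ?_
      · simp [Term.subst, Subst.id, Subst.single_self, a]
      · rw [hs q hq, Term.subst_id]
    · rw [hsub]
      refine hupd _ _ _ _ ?_ fun q hq => ?_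
      · simp [Term.subst, Subst.single_self, a, substActive, upd]
      · rw [hs q hq]
        exact hfix _ (fun α => rfl) q
  have hind : Nonempty (MvLKIE ((Sequent.mk {F.subst (substActive n .zero)} {F}).subst τ)) := by
    have hW := Sequent.actives_subst_eq_empty ⟨{F.subst (substActive n .zero)}, {F}⟩ hτ
    have hmk := MvInd.mk G 0 ∅ (τ.param (.active n)) (fun _ => .zero) 0 0
      (by simp [Sequent.params]) (by simp)
    have e₁ : G.subst (substActiveInternal 0 .zero ∅ fun _ => .zero) =
        (F.subst (substActive n .zero)).subst τ := by
      conv_rhs => rw [← hself, hsub, ← Formula.subst_id (F.subst _)]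
      refine hupd _ _ _ _ ?_ fun q hq => ?_
      · simp [Term.subst, a, substActiveInternal]
      · rw [Term.subst_id]
        exact hfix _ (fun α => rfl) q
    have e₂ : G.subst (substActiveInternal 0 (τ.param (.active n)) ∅ fun _ => .zero) =
        F.subst τ := by
      conv_rhs => rw [← hself, ← Formula.subst_id (F.subst _)]
      refine hupd _ _ _ _ ?_ fun q hq => ?_
      · rw [Term.subst_id]
        simp [Term.subst, a, substActiveInternal]
      · rw [Term.subst_id]
        exact hfix _ (fun α => rfl) q
    rw [e₁, e₂] at hmk
    obtain ⟨d⟩ := hstep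
    refine ⟨.rule ?_ hmk d⟩
    rw [Sequent.AtMostOneActive]
    exact Set.subsingleton_empty.anti hW.le
  have := (mvLKIE_calculus 0).binary ((Sequent.actives_subst_eq_empty ⟨0, {F}⟩ hτ).le.trans (Set.empty_subset _))
    (.cut ((F.subst (substActive n .zero)).subst τ) 0 0 0 {F.subst τ}) (h₀ τ hτ) hind
  exact this

-- In a suitable instance all internal and active parameters are fresh passive ones. They are turned
-- back one at a time, the active one last, because the exchange requires a sequent without active
-- parameters.
open Classical in
theorem Uniform.derivable {S : Sequent} (h : Uniform S) (hS : S.AtMostOneActive) :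
    Nonempty (MvLKIE S) := by
  obtain ⟨N, hN⟩ := exists_passive_bound S.params_finite
  -- Internal parameters outside `J` go to even offsets above `N` and active ones to odd offsets, so
  -- the stand-ins are distinct and do not occur in `S`.
  let ρ : Finset ℕ → Subst 0 0 := fun J => ⟨Term.bvar, fun p => match p with
    | .passive α => .param (.passive α)
    | .internal j => if j ∈ J then .param (.internal j) else .param (.passive (N + 2 * j))
    | .active n => .param (.passive (N + 2 * n + 1))⟩
  have hact : ∀ J, (S.subst (ρ J)).actives = ∅ := by
    intro J
    refine Set.eq_empty_of_forall_notMem fun n hn => ?_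
    obtain ⟨q, -, hq⟩ := Sequent.mem_params_subst.1 hn
    rcases q with j | j | j <;> simp only [ρ] at hq
    · cases hq
    · cases hq
    · split_ifs at hq <;> cases hq
  have hd : ∀ J, Nonempty (MvLKIE (S.subst (ρ J))) := by
    intro J
    induction J using Finset.induction_on with
    | empty =>
      refine h _ ?_
      rintro (j | j | j) <;> simp [ρ, Calculus.quantifiable_passive]
    | insert j J hj ih =>
      have := mvLKIE_subst_single (hact J) ih (β := N + 2 * j) (q := .internal j) (by simp)
      rw [Sequent.subst_subst] at this
      convert this using 2
      refine Sequent.subst_congr ?_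
      rintro (i | i | i) hi
      · simp only [ρ, Subst.comp, Term.subst]
        rw [Subst.single_of_ne]
        simp; omega
      · simp only [ρ, Subst.comp, Term.subst]
        rw [Subst.single_of_ne]
        have := hN i hi
        simp; omega
      · simp only [ρ, Subst.comp, Finset.mem_insert]
        by_cases hij : i = j
        · subst hij
          simp [hj, Term.subst, Subst.single_self]
        · by_cases hiJ : i ∈ J
          · simp [hiJ, Term.subst, Subst.single]
          · simp [hiJ, hij, Term.subst, Subst.single]
  have hfin : {j | Param.internal j ∈ S.params}.Finite :=
    S.params_finite.preimage (f := Param.internal) (fun a _ b _ h => by cases h; rfl)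
  have hd' := hd hfin.toFinset
  obtain ⟨n, hn⟩ : ∃ n, S.actives ⊆ {n} := by
    rcases hS.eq_empty_or_singleton with h | ⟨n, h⟩
    · exact ⟨0, by simp [h]⟩
    · exact ⟨n, h.le⟩
  have := mvLKIE_subst_single (hact _) hd' (β := N + 2 * n + 1) (q := .active n) (by simp)
  rw [Sequent.subst_subst, Sequent.subst_eq_self] at this
  · exact this
  rintro (i | i | i) hi
  · obtain rfl : i = n := hn hi
    simp [ρ, Subst.comp, Term.subst, Subst.single_self]
  · simp only [ρ, Subst.comp, Term.subst]
    rw [Subst.single_of_ne]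
    have := hN i hi
    simp; omega
  · simp only [ρ, Subst.comp]
    rw [if_pos (by simpa using hi)]
    simp [Term.subst, Subst.single]

/-! ### Encoding sequents by formulas -/

/-- The disjunction of a list of formulas. -/
def Formula.disj : List (Formula 0) → Formula 0
  | [] => .eq (.succ .zero) .zero
  | A :: l => .or A (Formula.disj l)

/-- The formula `A₁ → ⋯ → Aₖ → B`. -/
def Formula.imps : List (Formula 0) → Formula 0 → Formula 0
  | [], B => B
  | A :: l, B => .imp A (Formula.imps l B)

/-- A formula which is equivalent to the sequent `Γ ⊢ Δ`. -/
def Formula.encode (Γ Δ : List (Formula 0)) : Formula 0 := Formula.imps Γ (Formula.disj Δ)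

theorem Formula.subst_disj (σ : Subst 0 0) (l : List (Formula 0)) :
    (Formula.disj l).subst σ = Formula.disj (l.map (Formula.subst σ)) := by
  induction l <;> simp_all [Formula.disj, Formula.subst, Term.subst]

theorem Formula.subst_imps (σ : Subst 0 0) (l : List (Formula 0)) (B : Formula 0) :
    (Formula.imps l B).subst σ = Formula.imps (l.map (Formula.subst σ)) (B.subst σ) := by
  induction l <;> simp_all [Formula.imps, Formula.subst]

theorem Formula.subst_encode (σ : Subst 0 0) (Γ Δ : List (Formula 0)) :
    (Formula.encode Γ Δ).subst σ =
      Formula.encode (Γ.map (Formula.subst σ)) (Δ.map (Formula.subst σ)) := by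
  simp [Formula.encode, Formula.subst_imps, Formula.subst_disj]

theorem Formula.params_encode (Γ Δ : List (Formula 0)) :
    (Formula.encode Γ Δ).params ⊆ Sequent.params ⟨Γ, Δ⟩ := by
  have h₁ : ∀ p ∈ (Formula.disj Δ).params, ∃ A ∈ Δ, p ∈ A.params := by
    intro p
    induction Δ with
    | nil => simp [Formula.disj, Formula.params, Term.params]
    | cons A Δ ih =>
      rintro (h | h)
      · exact ⟨A, by simp, h⟩
      · obtain ⟨B, hB, h⟩ := ih h
        exact ⟨B, by simp [hB], h⟩
  have h₂ : ∀ B : Formula 0, ∀ p ∈ (Formula.imps Γ B).params,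
      (∃ A ∈ Γ, p ∈ A.params) ∨ p ∈ B.params := by
    intro B p
    induction Γ with
    | nil => exact fun h => Or.inr h
    | cons A Γ ih =>
      rintro (h | h)
      · exact Or.inl ⟨A, by simp, h⟩
      · exact (ih h).imp_left fun ⟨C, hC, h⟩ => ⟨C, by simp [hC], h⟩
  intro p hp
  rcases h₂ _ p hp with ⟨A, hA, h⟩ | h
  · exact Or.inl ⟨A, by simpa using hA, h⟩
  · obtain ⟨A, hA, h⟩ := h₁ p h
    exact Or.inr ⟨A, by simpa using hA, h⟩

/-! ### Uniform equivalence of a sequent with its encoding -/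

theorem Uniform.mono {Γ Γ' Δ Δ' : Multiset (Formula 0)} (h : Uniform ⟨Γ, Δ⟩) (hΓ : Γ ⊆ Γ')
    (hΔ : Δ ⊆ Δ') : Uniform ⟨Γ', Δ'⟩ :=
  uniform_calculus.mono h hΓ hΔ (Set.subset_univ _)

theorem Uniform.id (A : Formula 0) : Uniform ⟨{A}, {A}⟩ :=
  uniform_calculus.initial (Set.subset_univ _) (.id A)

theorem Uniform.cut {Γ Δ : Multiset (Formula 0)} {A : Formula 0} (h₁ : Uniform ⟨Γ, A ::ₘ Δ⟩)
    (h₂ : Uniform ⟨A ::ₘ Γ, Δ⟩) : Uniform ⟨Γ, Δ⟩ :=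
  uniform_calculus.cut h₁ h₂ (Set.subset_univ _)

theorem Uniform.binary {S₁ S₂ S : Sequent} (h : Binary S₁ S₂ S) (h₁ : Uniform S₁)
    (h₂ : Uniform S₂) : Uniform S :=
  uniform_calculus.binary (Set.subset_univ _) h h₁ h₂

theorem uniform_mem_disj {A : Formula 0} {l : List (Formula 0)} (h : A ∈ l) :
    Uniform ⟨{A}, {Formula.disj l}⟩ := by
  induction l with
  | nil => cases h
  | cons B l ih =>
    rcases List.mem_cons.1 h with rfl | h
    · exact .unary (.orR₁ A (Formula.disj l) _ 0) (.id A)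
    · exact .unary (.orR₂ B (Formula.disj l) _ 0) (ih h)

theorem uniform_disj (l : List (Formula 0)) : Uniform ⟨{Formula.disj l}, l⟩ := by
  induction l with
  -- The empty disjunction is `s(0) = 0`, refuted by an initial sequent.
  | nil => exact uniform_calculus.initial (Set.subset_univ _) (.succ_ne_zero _)
  | cons A l ih =>
    refine .binary (.orL A (Formula.disj l) 0 _) ?_ ?_
    · exact (Uniform.id A).mono (Multiset.Subset.refl _) (by simp)
    · refine Uniform.mono ih (Multiset.Subset.refl _) ?_
      rw [← Multiset.cons_coe]
      exact Multiset.subset_cons _ _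

theorem Uniform.encode {Θ : Multiset (Formula 0)} {Γ Δ : List (Formula 0)}
    (h : Uniform ⟨Θ + Γ, Δ⟩) : Uniform ⟨Θ, {Formula.encode Γ Δ}⟩ := by
  induction Γ generalizing Θ with
  | nil =>
    refine uniform_calculus.multicut (by simpa using h) (fun A hA => ?_) (fun A hA => ?_)
      (Set.subset_univ _) (Set.subset_univ _)
    · exact (Uniform.id A).mono (by simpa using hA) (by simp)
    · exact Uniform.mono (uniform_mem_disj hA) (by simp) (Multiset.Subset.refl _)
  | cons A Γ ih =>
    refine .unary (.impR A (Formula.encode Γ Δ) _ 0) (ih ?_)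
    rwa [Multiset.cons_add, ← Multiset.add_cons, Multiset.cons_coe]

theorem uniform_encode (Γ Δ : List (Formula 0)) :
    Uniform ⟨Formula.encode Γ Δ ::ₘ Γ, Δ⟩ := by
  induction Γ with
  | nil => exact uniform_disj Δ
  | cons A Γ ih =>
    have := Uniform.binary (.impL A (Formula.encode Γ Δ) {A} 0 Γ Δ) (.id A) ih
    simpa [Formula.encode, Formula.imps] using this

theorem Uniform.of_encode {Θ : Multiset (Formula 0)} {Γ Δ : List (Formula 0)}
    (h : Uniform ⟨Θ, {Formula.encode Γ Δ}⟩) : Uniform ⟨Θ + Γ, Δ⟩ := by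
  refine Uniform.cut (A := Formula.encode Γ Δ) (h.mono (Multiset.subset_of_le le_self_add) ?_)
    ((uniform_encode Γ Δ).mono (Multiset.cons_subset_cons (Multiset.subset_of_le le_add_self))
      (Multiset.Subset.refl _))
  simp

/-! ### Universal closure -/

/-- The universal closure of a formula in the scope of `k` quantifiers. -/
def Formula.allN : (k : ℕ) → Formula k → Formula 0
  | 0, A => A
  | k + 1, A => Formula.allN k A.all

theorem Formula.params_allN : ∀ (k : ℕ) (A : Formula k), (Formula.allN k A).params = A.params
  | 0, _ => rfl
  | k + 1, A => Formula.params_allN k A.all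

/-- Only eigenvariables are ever used as values. Asking for all `v` allows each eigenvariable to be
chosen fresh for the values not yet fixed. -/
theorem Uniform.allN_right {Γ : Multiset (Formula 0)} {σ : Subst 0 0} : ∀ {k : ℕ} {B : Formula k},
    (∀ v : Fin k → Term 0, Uniform ⟨Γ, {B.subst ⟨v, σ.param⟩}⟩) →
    Uniform ⟨Γ, {(Formula.allN k B).subst σ}⟩
  | 0, B, h => by
    rw [show σ = ⟨σ.bvar, σ.param⟩ from rfl]
    exact h _
  | k + 1, B, h => by
    refine Uniform.allN_right (B := B.all) fun v => ?_
    obtain ⟨α, hα⟩ := Calculus.exists_fresh ⟨Γ, {B.all.subst ⟨v, σ.param⟩}⟩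
    refine .unary (.allR _ α Γ 0 hα) ?_
    rw [Formula.subst_lift_inst]
    exact h _

theorem uniform_allN_left {σ : Subst 0 0} : ∀ {k : ℕ} {B : Formula k} (v : Fin k → Term 0),
    Uniform ⟨{(Formula.allN k B).subst σ}, {B.subst ⟨v, σ.param⟩}⟩
  | 0, B, v => by
    rw [show σ = ⟨v, σ.param⟩ from Subst.ext' (fun i => i.elim0) fun _ => rfl]
    exact .id _
  | k + 1, B, v => by
    have h₁ := uniform_allN_left (σ := σ) (B := B.all) fun i => v i.succ
    have h₂ : Uniform ⟨{B.all.subst ⟨fun i => v i.succ, σ.param⟩}, {B.subst ⟨v, σ.param⟩}⟩ := by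
      refine Uniform.allL (Γ := 0) (v 0) ?_
      rw [Formula.subst_lift_inst]
      have : B.subst ⟨Fin.cases (v 0) fun i => v i.succ, σ.param⟩ = B.subst ⟨v, σ.param⟩ := by
        congr 2
        funext i
        exact Fin.cases rfl (fun _ => rfl) i
      rw [this]
      exact .id _
    exact .binary (.cut _ _ 0 0 _) h₁ h₂

/-! ### Schemata are uniformly derivable -/

open Classical in
/-- Induction where the induction hypothesis may be used with arbitrary arguments for all parameters
but the active one. -/
theorem uniform_of_step {S : Sequent} {n : ℕ} (h₀ : Uniform (S.subst (substActive n .zero)))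
    (hs : ∀ G : Formula 0, (∀ α, .passive α ∉ G.params) →
      (∀ σ : Subst 0 0, σ.param (.active n) = .param (.active n) →
        Uniform ⟨{G} + (S.subst σ).ante, (S.subst σ).succ⟩) →
      Uniform ⟨{G} + (S.subst (substActive n (.succ (.param (.active n))))).ante,
        (S.subst (substActive n (.succ (.param (.active n))))).succ⟩) :
    Uniform S := by
  obtain ⟨Γ, Δ, rfl⟩ : ∃ Γ Δ : List (Formula 0), S = ⟨Γ, Δ⟩ :=
    ⟨S.ante.toList, S.succ.toList, by simp⟩
  set S : Sequent := ⟨Γ, Δ⟩ with hS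
  -- `f` lists the parameters of `S` other than `n`: the ones to be universally quantified. Below,
  -- `c` makes them bound variables, and `inst v` gives them the values `v`.
  obtain ⟨k, f, -, hf⟩ := (S.params_finite.subset
    (Set.sdiff_subset (t := {Param.active n}))).fin_param
  have hfn : ¬ ∃ i, f i = .active n := by
    rintro ⟨i, hi⟩
    have : f i ∈ S.params \ {Param.active n} := hf ▸ Set.mem_range_self i
    exact this.2 hi
  have hfS : ∀ p ∈ S.params, p ≠ .active n → ∃ i, f i = p := by
    intro p hp hpn
    have : p ∈ Set.range f := by rw [hf]; exact ⟨hp, hpn⟩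
    exact this
  let c : Subst 0 k := ⟨fun i => i.elim0,
    fun p => if h : ∃ i, f i = p then .bvar h.choose else .param p⟩
  let inst : (Fin k → Term 0) → Subst 0 0 := fun v => ⟨Term.bvar,
    fun p => if h : ∃ i, f i = p then v h.choose else .param p⟩
  have hinst : ∀ v, (inst v).param (.active n) = .param (.active n) := by
    intro v
    simp only [inst, dif_neg hfn]
  have hc : ∀ (v : Fin k → Term 0) (t : Term 0), t.subst (inst v) = t →
      (S.subst (substActive n t)).subst (inst v) =
        S.subst (c.comp ⟨v, (substActive n t).param⟩) := by
    intro v t ht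
    rw [Sequent.subst_subst]
    refine Sequent.subst_congr fun p hp => ?_
    by_cases hpn : p = .active n
    · subst hpn
      simp [Subst.comp, c, dif_neg hfn, substActive, ht, Term.subst]
    · have hex := hfS p hp hpn
      have hsp : (substActive n t).param p = .param p := by
        rcases p with j | j | j <;> simp only [substActive]
        rw [if_neg]
        rintro rfl
        exact hpn rfl
      simp [Subst.comp, c, inst, dif_pos hex, hsp, Term.subst]
  let A := Formula.encode Γ Δ
  let G := Formula.allN k (A.subst c)
  have hG : ∀ p ∈ G.params, p = .active n := by
    intro p hp
    simp only [G, Formula.params_allN] at hp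
    obtain ⟨q, hq, hp⟩ := Formula.mem_params_subst_zero hp
    have hqS := Formula.params_encode Γ Δ hq
    by_cases hqn : q = .active n
    · subst hqn
      simp only [c, dif_neg hfn] at hp
      exact hp
    · simp only [c, dif_pos (hfS q hqS hqn)] at hp
      exact hp.elim
  -- Instantiating the quantifiers of `G` by the values of `σ` gives the encoded instance of `S`.
  -- The variable `n` is free in `G`, hence the condition that `σ` fixes it.
  have hleaf : ∀ σ : Subst 0 0, σ.param (.active n) = .param (.active n) →
      Uniform ⟨{G} + (S.subst σ).ante, (S.subst σ).succ⟩ := by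
    intro σ hσ
    have h := uniform_allN_left (σ := Subst.id 0) (B := A.subst c) fun i => σ.param (f i)
    rw [Formula.subst_id, Formula.subst_subst] at h
    have hA : A.subst (c.comp ⟨fun i => σ.param (f i), (Subst.id 0).param⟩) = A.subst σ := by
      refine A.subst_congr (fun i => i.elim0) fun p hp => ?_
      by_cases hpn : p = .active n
      · subst hpn
        simp [Subst.comp, c, dif_neg hfn, Term.subst, Subst.id, hσ]
      · have hex := hfS p (Formula.params_encode Γ Δ hp) hpn
        simp [Subst.comp, c, dif_pos hex, Term.subst, hex.choose_spec]
    rw [hA, Formula.subst_encode] at h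
    exact h.of_encode
  have hGG : Uniform ⟨0, {G}⟩ := by
    refine Uniform.induction (n := n) (Uniform.allN_right fun v => ?_)
      (Uniform.allN_right fun v => ?_)
    · have h := h₀.subst (inst v)
      rw [hc v _ rfl] at h
      rw [Formula.subst_subst, Formula.subst_encode]
      exact Uniform.encode (by simpa [Sequent.subst, hS] using h)
    -- The only parameter of `G` is the active `n`. It therefore qualifies as a context free of
    -- passive parameters and is untouched by `inst v`.
    · have h := (hs G (fun α hα => by cases hG _ hα) hleaf).subst (inst v)
      have hGv : G.subst (inst v) = G :=
        G.subst_eq_self fun p hp => by rw [hG p hp]; exact hinst v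
      have h' : Uniform ⟨{G} + (S.subst (c.comp
          ⟨v, (substActive n (.succ (.param (.active n)))).param⟩)).ante,
          (S.subst (c.comp ⟨v, (substActive n (.succ (.param (.active n)))).param⟩)).succ⟩ := by
        rw [← hc v _ (by simp [Term.subst, hinst])]
        simpa [Sequent.subst, hGv] using h
      rw [Formula.subst_subst, Formula.subst_encode]
      exact Uniform.encode (by simpa [Sequent.subst, hS] using h')
  have h := hleaf (Subst.id 0) rfl
  rw [Sequent.subst_id] at h
  have := Uniform.binary (.cut G 0 0 S.ante S.succ) hGG h
  simpa using this

/-- Derivations with uniformly derivable links. -/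
theorem uniform_of_mvLKS {S : Sequent} (d : MvLKS S) {Θ : Multiset (Formula 0)}
    (hΘ : ∀ A ∈ Θ, ∀ α, .passive α ∉ A.params)
    (hd : ∀ (T : Sequent) (ℓ : Link), ⟨T, ℓ⟩ ∈ d.leaves → Uniform ⟨Θ + T.ante, T.succ⟩) :
    Uniform ⟨Θ + S.ante, S.succ⟩ := by
  induction d with
  | initial _ h =>
    exact Uniform.mono (uniform_calculus.initial (Set.subset_univ _) h)
      (Multiset.subset_of_le le_add_self) (Multiset.Subset.refl _)
  | leaf _ ℓ => exact hd _ ℓ rfl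
  | unary _ h d ih => exact .unary (h.add_left hΘ) (ih hd)
  | rule _ h => exact h.elim
  | binary _ h d₁ d₂ ih₁ ih₂ =>
    have h₁ := ih₁ fun T ℓ hℓ => hd T ℓ (Or.inl hℓ)
    have h₂ := ih₂ fun T ℓ hℓ => hd T ℓ (Or.inr hℓ)
    cases h with
    | cut A Γ Δ Γ' Δ' =>
      simp only [Multiset.add_cons] at h₁ h₂
      -- The context `Θ` arrives once from each premise and is contracted.
      refine (Uniform.binary (.cut A _ _ _ _) h₁ h₂).mono ?_ (Multiset.Subset.refl _)
      intro B; simp only [Multiset.mem_add]; tauto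
    | andR A B Γ Δ => exact .binary (.andR A B _ _) h₁ h₂
    | orL A B Γ Δ =>
      simp only [Multiset.add_cons] at h₁ h₂ ⊢
      exact .binary (.orL A B _ _) h₁ h₂
    | impL A B Γ Δ Γ' Δ' =>
      simp only [Multiset.add_cons] at h₁ h₂ ⊢
      refine (Uniform.binary (.impL A B _ _ _ _) h₁ h₂).mono ?_ (Multiset.Subset.refl _)
      intro C; simp only [Multiset.mem_cons, Multiset.mem_add]; tauto

/-- Links other than recursive calls go upwards in `lt`, so the induction runs from the maximal
components down. The converse of `lt` is well founded because there are finitely many components;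
the well-foundedness of `lt` itself only contributes irreflexivity. -/
theorem PSchema.uniform {P : Set ℕ} (Ψ : PSchema P) (i : Fin (Ψ.length + 1)) :
    Uniform (Ψ.comp i).endSequent := by
  have : IsTrans _ (Function.swap Ψ.lt) := ⟨fun a b c h₁ h₂ => Ψ.lt_trans c b a h₂ h₁⟩
  have : Std.Irrefl (Function.swap Ψ.lt) := ⟨fun a h => Ψ.lt_wellFounded.irrefl.irrefl a h⟩
  have hwf : WellFounded (Function.swap Ψ.lt) := Finite.wellFounded_of_trans_of_irrefl _
  induction i using hwf.induction with
  | _ i ih =>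
  refine uniform_of_step (n := (Ψ.comp i).n) ?_ fun G hG hrec => ?_
  · have := uniform_of_mvLKS (Ψ.comp i).base (Θ := 0) (by simp) fun T ℓ hℓ => ?_
    · simpa using this
    obtain ⟨j, -, rfl, hj⟩ := Ψ.link_base i T ℓ hℓ
    simpa using (ih j hj).subst ℓ.subst
  · refine uniform_of_mvLKS (Ψ.comp i).step (by simpa using hG) fun T ℓ hℓ => ?_
    obtain ⟨j, -, rfl, hj | ⟨rfl, harg⟩⟩ := Ψ.link_step i T ℓ hℓ
    · exact Uniform.mono ((ih j hj).subst ℓ.subst) (Multiset.subset_of_le le_add_self)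
        (Multiset.Subset.refl _)
    · exact hrec _ harg

theorem PSchema.derivable {P : Set ℕ} (Ψ : PSchema P) : Nonempty (MvLKIE Ψ.endSequent) :=
  (Ψ.uniform 0).derivable (Set.subsingleton_singleton.anti (Ψ.comp 0).actives_subset)

/-! ### From derivations with induction to schemata -/

/-- The substitution of a term for all active parameters. -/
def allActive (u : Term 0) : Subst 0 0 :=
  ⟨Term.bvar, fun p => match p with
    | .active _ => u
    | .passive j => .param (.passive j)
    | .internal j => .param (.internal j)⟩

/-- The active parameters of a term. -/
def Term.actives (t : Term 0) : Set ℕ := {n | .active n ∈ t.params}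

/-- There is an `mvLKS`-derivation of `S` with active parameters in `W` and links in `Q`. -/
def LinkDerivable (Q : Sequent → Link → Prop) (W : Set ℕ) (S : Sequent) : Prop :=
  ∃ d : MvLKS S, (∀ T ∈ d.sequents, T.actives ⊆ W) ∧
    ∀ (T : Sequent) (ℓ : Link), ⟨T, ℓ⟩ ∈ d.leaves → Q T ℓ

theorem linkDerivable_calculus (Q : Sequent → Link → Prop) {W : Set ℕ} (hW : W.Subsingleton) :
    Calculus W (LinkDerivable Q W) where
  initial hS h := ⟨.initial (hW.anti hS) h, by simpa [Derivation.sequents] using hS,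
    by simp [Derivation.leaves]⟩
  unary hS h := by
    rintro ⟨d, h₁, h₂⟩
    refine ⟨.unary (hW.anti hS) h d, ?_, h₂⟩
    rintro T (rfl | hT)
    exacts [hS, h₁ T hT]
  binary hS h := by
    rintro ⟨d₁, h₁, h₂⟩ ⟨d₂, h₃, h₄⟩
    refine ⟨.binary (hW.anti hS) h d₁ d₂, ?_, ?_⟩
    · rintro T ((rfl | hT) | hT)
      exacts [hS, h₁ T hT, h₃ T hT]
    · rintro T ℓ (h | h)
      exacts [h₂ T ℓ h, h₄ T ℓ h]

theorem LinkDerivable.leaf {Q : Sequent → Link → Prop} {W : Set ℕ} (hW : W.Subsingleton)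
    {S : Sequent} (hS : S.actives ⊆ W) {ℓ : Link} (hQ : Q S ℓ) : LinkDerivable Q W S := by
  refine ⟨.leaf (hW.anti hS) ℓ, by simpa [Derivation.sequents] using hS, ?_⟩
  intro T ℓ' h
  have h : (⟨T, ℓ'⟩ : Σ _ : Sequent, Link) = ⟨S, ℓ⟩ := h
  cases h
  exact hQ

theorem LinkDerivable.imp {Q Q' : Sequent → Link → Prop} {W : Set ℕ} {S : Sequent}
    (h : LinkDerivable Q W S) (hQ : ∀ T ℓ, Q T ℓ → Q' T ℓ) : LinkDerivable Q' W S := by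
  obtain ⟨d, h₁, h₂⟩ := h
  exact ⟨d, h₁, fun T ℓ h => hQ T ℓ (h₂ T ℓ h)⟩

/-- Links to one of the components in `E`. -/
def LinkTo (E : List Component) (T : Sequent) (ℓ : Link) : Prop :=
  ∃ C ∈ E, ℓ.symbol = C.symbol ∧ T = C.endSequent.subst ℓ.subst ∧
    C.endSequent.passives ⊆ T.passives

/-- Recursive calls. -/
def RecursiveLink (symbol n : ℕ) (S T : Sequent) (ℓ : Link) : Prop :=
  ℓ.symbol = symbol ∧ T = S.subst ℓ.subst ∧ ℓ.arg = .param (.active n)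

/-- Sequences of components where every component is only linked to itself and to the components
which follow it. -/
inductive Linked : List Component → Prop
  | nil : Linked []
  | cons {C : Component} {E : List Component} : Linked E → C.symbol = E.length →
      (∀ T ℓ, ⟨T, ℓ⟩ ∈ C.base.leaves → LinkTo E T ℓ) →
      (∀ T ℓ, ⟨T, ℓ⟩ ∈ C.step.leaves →
        LinkTo E T ℓ ∨ RecursiveLink C.symbol C.n C.endSequent T ℓ) → Linked (C :: E)

theorem exists_component {E : List Component} (hE : Linked E) {S : Sequent} {n : ℕ}
    (hS : S.actives ⊆ {n}) (h₀ : LinkDerivable (LinkTo E) ∅ (S.subst (substActive n .zero)))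
    (h₁ : LinkDerivable (fun T ℓ => LinkTo E T ℓ ∨ RecursiveLink E.length n S T ℓ) {n}
      (S.subst (substActive n (.succ (.param (.active n)))))) :
    ∃ C : Component, C.endSequent = S ∧ C.symbol = E.length ∧ Linked (C :: E) := by
  obtain ⟨d₀, ha₀, hl₀⟩ := h₀
  obtain ⟨d₁, ha₁, hl₁⟩ := h₁
  let C : Component := ⟨E.length, n, S.internals, S, hS, rfl, d₀, d₁,
    fun T hT => Set.subset_empty_iff.1 (ha₀ T hT), ha₁⟩
  exact ⟨C, rfl, rfl, .cons hE rfl hl₀ hl₁⟩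

/-! ### Translation of the single inference rules -/

theorem Sequent.actives_subst_allActive (S : Sequent) (u : Term 0) :
    (S.subst (allActive u)).actives ⊆ u.actives := by
  intro n hn
  obtain ⟨q, -, hq⟩ := Sequent.mem_params_subst.1 hn
  rcases q with j | j | j
  · exact hq
  · cases hq
  · cases hq

theorem Sequent.subst_allActive_eq {S : Sequent} {n : ℕ} (hS : S.actives ⊆ {n}) (t : Term 0) :
    S.subst (allActive t) = S.subst (substActive n t) := by
  refine Sequent.subst_congr ?_
  rintro (j | j | j) hp
  · obtain rfl : j = n := hS hp
    simp [allActive, substActive]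
  · rfl
  · rfl

theorem Sequent.subst_allActive_self {S : Sequent} {n : ℕ} (hS : S.actives ⊆ {n}) :
    S.subst (allActive (.param (.active n))) = S := by
  refine Sequent.subst_eq_self ?_
  rintro (j | j | j) hp
  · obtain rfl : j = n := hS hp
    simp [allActive]
  · rfl
  · rfl

/-- Passive parameters are fixed and `u` brings in none, so every eigenvariable remains fresh. -/
theorem Unary.subst_allActive {S S' : Sequent} (h : Unary S S') {u : Term 0}
    (hu : ∀ α, .passive α ∉ u.params) :
    Unary (S.subst (allActive u)) (S'.subst (allActive u)) := by
  refine h.subst (fun α => Calculus.quantifiable_passive α) fun α hα => ⟨α, rfl, fun q hq h => ?_⟩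
  rcases q with j | j | j
  · exact hu α h
  · cases h; exact hα hq
  · cases h

/-- The invariant of the translation of derivations with induction. -/
def Translatable (S : Sequent) : Prop :=
  ∀ E : List Component, Linked E → ∃ L : List Component, Linked (L ++ E) ∧
    ∀ u : Term 0, u.actives.Subsingleton → (∀ α, .passive α ∉ u.params) →
      LinkDerivable (LinkTo (L ++ E)) u.actives (S.subst (allActive u))

theorem LinkTo.append {E : List Component} {T : Sequent} {ℓ : Link} (h : LinkTo E T ℓ)
    (L : List Component) : LinkTo (L ++ E) T ℓ := by
  obtain ⟨C, hC, h⟩ := h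
  exact ⟨C, List.mem_append_right L hC, h⟩

theorem translatable_initial {S : Sequent} (h : Initial S) : Translatable S :=
  fun _ hE => ⟨[], hE, fun u hu _ => (linkDerivable_calculus _ hu).initial
    (S.actives_subst_allActive u) (h.subst _)⟩

theorem Translatable.unary {S S' : Sequent} (h : Unary S S') (hS : Translatable S) :
    Translatable S' := by
  intro E hE
  obtain ⟨L, hL, hd⟩ := hS E hE
  exact ⟨L, hL, fun u hu hp => (linkDerivable_calculus _ hu).unary
    (S'.actives_subst_allActive u) (h.subst_allActive hp) (hd u hu hp)⟩

/-- The components for the second premise are stacked on those for the first, whose links stay valid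
in the longer list. This is why the invariant quantifies over the initial list `E`. -/
theorem Translatable.binary {S₁ S₂ S : Sequent} (h : Binary S₁ S₂ S) (h₁ : Translatable S₁)
    (h₂ : Translatable S₂) : Translatable S := by
  intro E hE
  obtain ⟨L₁, hL₁, hd₁⟩ := h₁ E hE
  obtain ⟨L₂, hL₂, hd₂⟩ := h₂ _ hL₁
  refine ⟨L₂ ++ L₁, by rwa [List.append_assoc], fun u hu hp => ?_⟩
  rw [List.append_assoc]
  exact (linkDerivable_calculus _ hu).binary (S.actives_subst_allActive u) (h.subst _)
    ((hd₁ u hu hp).imp fun T ℓ h => h.append L₂) (hd₂ u hu hp)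

theorem Translatable.mvInd {S S' : Sequent} (h : MvInd S S') (ha : S.AtMostOneActive)
    (hS : Translatable S) : Translatable S' := by
  obtain ⟨F, n, M, t, a, Γ, Δ, hn, hM⟩ := h
  -- If `n` does not occur in `F`, the premise may have a different active parameter in its context,
  -- and no `n`-component is available. But then both instances of `F` in the conclusion coincide,
  -- and it is a weakened axiom.
  by_cases hF : .active n ∈ F.params
  swap
  · have heq : F.subst (substActiveInternal n .zero M a) =
        F.subst (substActiveInternal n t M a) := by
      refine F.subst_congr (fun i => i.elim0) ?_
      rintro (j | j | j) hp
      · have : j ≠ n := by rintro rfl; exact hF hp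
        simp [substActiveInternal, this]
      · rfl
      · rfl
    rw [heq]
    intro E hE
    refine ⟨[], hE, fun u hu _ => ?_⟩
    have hX := linkDerivable_calculus (LinkTo ([] ++ E)) hu
    have hact := Sequent.actives_subst_allActive ⟨F.subst (substActiveInternal n t M a) ::ₘ Γ,
      F.subst (substActiveInternal n t M a) ::ₘ Δ⟩ u
    refine hX.mono (hX.initial ?_ (.id ((F.subst (substActiveInternal n t M a)).subst
      (allActive u)))) ?_ ?_ hact
    · refine (Sequent.actives_subset_iff.2 ⟨?_, ?_⟩)
      · simpa using (Sequent.actives_subset_iff.1 hact).1 _ (Multiset.mem_map_of_mem _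
          (Multiset.mem_cons_self _ _))
      · simpa using (Sequent.actives_subset_iff.1 hact).1 _ (Multiset.mem_map_of_mem _
          (Multiset.mem_cons_self _ _))
    · simp
    · simp
  -- otherwise `n` is the only active parameter of the premise
  set F₁ := F.subst (substActive n (.succ (.param (.active n)))) with hF₁
  set F₀ := F.subst (substActive n .zero) with hF₀
  have hSn : Sequent.actives ⟨F ::ₘ Γ, F₁ ::ₘ Δ⟩ ⊆ {n} := fun m hm =>
    ha hm (Or.inl ⟨F, Multiset.mem_cons_self _ _, hF⟩)
  have hSn' := Sequent.actives_subset_iff.1 hSn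
  have hFn : F.actives ⊆ {n} := hSn'.1 F (Multiset.mem_cons_self _ _)
  have hF₁n : F₁.actives ⊆ {n} := hSn'.2 F₁ (Multiset.mem_cons_self _ _)
  have hctx : Sequent.actives ⟨Γ, Δ⟩ = ∅ := by
    refine Set.eq_empty_of_forall_notMem fun m hm => ?_
    have : m = n := by
      refine hSn ?_
      rcases hm with ⟨A, hA, h⟩ | ⟨A, hA, h⟩
      · exact Or.inl ⟨A, Multiset.mem_cons_of_mem hA, h⟩
      · exact Or.inr ⟨A, Multiset.mem_cons_of_mem hA, h⟩
    exact hn (this ▸ hm)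
  have hctx' : Sequent.actives ⟨Γ, Δ⟩ ⊆ ∅ := hctx.le
  rw [Sequent.actives_subset_iff] at hctx'
  have hF₀n : F₀.actives ⊆ ∅ := by
    intro m hm
    obtain ⟨q, hq, hm⟩ := Formula.mem_params_subst_zero hm
    rcases q with j | j | j
    · obtain rfl : j = n := hFn hq
      simp [substActive, Term.params] at hm
    · cases hm
    · cases hm
  intro E hE
  obtain ⟨L, hL, hd⟩ := hS E hE
  -- The end-sequent of the new component; the conclusion of the inference is its instance at `n ←
  -- t`, `𝐦 ← 𝐚`.
  let D : Sequent := ⟨F₀ ::ₘ Γ, F ::ₘ Δ⟩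
  have hD : D.actives ⊆ {n} := Sequent.actives_subset_iff.2
    ⟨Multiset.forall_mem_cons.2 ⟨hF₀n.trans (Set.empty_subset _),
      fun A hA => (hctx'.1 A hA).trans (Set.empty_subset _)⟩,
      Multiset.forall_mem_cons.2 ⟨hFn,
      fun A hA => (hctx'.2 A hA).trans (Set.empty_subset _)⟩⟩
  have hctxσ : ∀ σ : Subst 0 0, (∀ p ∈ Sequent.params ⟨Γ, Δ⟩, σ.param p = .param p) →
      Γ.map (Formula.subst σ) = Γ ∧ Δ.map (Formula.subst σ) = Δ := by
    intro σ hσ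
    have := Sequent.subst_eq_self hσ
    simpa [Sequent.subst] using this
  have hctxa : ∀ m, Param.active m ∉ Sequent.params ⟨Γ, Δ⟩ := by
    intro m hm
    have : m ∈ Sequent.actives ⟨Γ, Δ⟩ := hm
    simp [hctx] at this
  have hctx₁ : ∀ s, Γ.map (Formula.subst (substActive n s)) = Γ ∧
      Δ.map (Formula.subst (substActive n s)) = Δ := by
    intro s
    refine hctxσ _ ?_
    rintro (j | j | j) hp
    · exact (hctxa j hp).elim
    · rfl
    · rfl
  have hF₀s : ∀ s, F₀.subst (substActive n s) = F₀ := by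
    intro s
    refine F₀.subst_eq_self ?_
    rintro (j | j | j) hp
    · exact (hF₀n hp).elim
    · rfl
    · rfl
  have hDs : ∀ s, D.subst (substActive n s) = ⟨F₀ ::ₘ Γ, F.subst (substActive n s) ::ₘ Δ⟩ := by
    intro s
    simp [D, Sequent.subst, hctx₁ s, hF₀s s]
  obtain ⟨C, hCD, hCs, hC⟩ : ∃ C : Component, C.endSequent = D ∧ C.symbol = (L ++ E).length ∧
      Linked (C :: (L ++ E)) := by
    refine exists_component hL hD ?_ ?_
    · have hX := linkDerivable_calculus (LinkTo (L ++ E)) Set.subsingleton_empty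
      rw [hDs]
      refine hX.mono (hX.initial ?_ (.id F₀)) (by simp) (by simp [hF₀]) ?_
      · exact Sequent.actives_subset_iff.2 ⟨by simpa using hF₀n, by simpa using hF₀n⟩
      · exact Sequent.actives_subset_iff.2 ⟨Multiset.forall_mem_cons.2 ⟨hF₀n, hctx'.1⟩,
          Multiset.forall_mem_cons.2 ⟨hF₀n, hctx'.2⟩⟩
    · have hX := linkDerivable_calculus (fun T ℓ => LinkTo (L ++ E) T ℓ ∨
        RecursiveLink (L ++ E).length n D T ℓ) (Set.subsingleton_singleton (a := n))
      -- The recursive call at `n` with identity arguments, whose sequent is `D` itself.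
      have hrec : LinkDerivable (fun T ℓ => LinkTo (L ++ E) T ℓ ∨
          RecursiveLink (L ++ E).length n D T ℓ) {n} D := by
        refine LinkDerivable.leaf Set.subsingleton_singleton hD (ℓ := ⟨(L ++ E).length,
          .param (.active n), fun j => .param (.internal j), fun j => .param (.passive j)⟩)
          (Or.inr ⟨rfl, ?_, rfl⟩)
        symm
        refine Sequent.subst_eq_self ?_
        rintro (j | j | j) hp
        · obtain rfl : j = n := hD hp
          rfl
        · rfl
        · rfl
      have hprem := hd (.param (.active n)) (by simp [Term.actives, Term.params])
        (by simp [Term.params])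
      rw [Sequent.subst_allActive_self hSn] at hprem
      have hna : Term.actives (.param (.active n)) = {n} := by
        ext m; simp [Term.actives, Term.params]
      rw [hna] at hprem
      have hΓn : ∀ A ∈ Γ, A.actives ⊆ {n} := fun A hA =>
        (hctx'.1 A hA).trans (Set.empty_subset _)
      have hΔn : ∀ A ∈ Δ, A.actives ⊆ {n} := fun A hA =>
        (hctx'.2 A hA).trans (Set.empty_subset _)
      have hF₀n' : F₀.actives ⊆ {n} := hF₀n.trans (Set.empty_subset _)
      rw [hDs]
      -- Cut on `F(n)` between the recursive call `F(0), Γ ⊢ Δ, F(n)` and the premise `F(n), Γ ⊢ Δ,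
      -- F(s(n))`.
      refine hX.mono (hX.binary ?_ (.cut F (F₀ ::ₘ Γ) Δ Γ (F₁ ::ₘ Δ)) hrec
        (hprem.imp fun T ℓ h => Or.inl h)) ?_ ?_ ?_
      · refine Sequent.actives_subset_iff.2 ⟨?_, ?_⟩
        · rw [Multiset.cons_add]
          exact Multiset.forall_mem_cons.2 ⟨hF₀n', fun A hA =>
            hΓn A ((Multiset.mem_add.1 hA).elim id id)⟩
        · rw [Multiset.add_cons]
          exact Multiset.forall_mem_cons.2 ⟨hF₁n, fun A hA =>
            hΔn A ((Multiset.mem_add.1 hA).elim id id)⟩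
      · intro A; simp
      · intro A; simp [hF₁]
      · exact Sequent.actives_subset_iff.2 ⟨Multiset.forall_mem_cons.2 ⟨hF₀n', hΓn⟩,
          Multiset.forall_mem_cons.2 ⟨hF₁n, hΔn⟩⟩
  refine ⟨C :: L, hC, fun u hu hp => ?_⟩
  -- The substitution for the active parameters of the conclusion is absorbed into the arguments `t`
  -- and `𝐚`. Passive arguments are the identity, as linkability will require.
  refine LinkDerivable.leaf hu (Sequent.actives_subst_allActive _ u) (ℓ := ⟨(L ++ E).length,
    t.subst (allActive u), fun j => if j ∈ M then (a j).subst (allActive u) else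
      .param (.internal j), fun j => .param (.passive j)⟩) ?_
  refine ⟨C, by simp, hCs.symm, ?_, ?_⟩
  · rw [hCD]
    have h₁ := hctxσ (allActive u) (by
      rintro (j | j | j) hp
      · exact (hctxa j hp).elim
      · rfl
      · rfl)
    have h₂ := hctxσ (Link.subst ⟨(L ++ E).length,
      t.subst (allActive u), fun j => if j ∈ M then (a j).subst (allActive u) else
      .param (.internal j), fun j => .param (.passive j)⟩) (by
      rintro (j | j | j) hp
      · exact (hctxa j hp).elim
      · rfl
      · have : j ∉ M := fun hj => hM j hj hp
        simp [Link.subst, this])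
    simp only [Sequent.subst, D, Multiset.map_cons, h₁, h₂, Sequent.mk.injEq,
      Multiset.cons_inj_left, hF₀, Formula.subst_subst]
    constructor
    · refine F.subst_congr (fun i => i.elim0) ?_
      rintro (j | j | j) hp
      · obtain rfl : j = n := hFn hp
        simp [Subst.comp, substActiveInternal, substActive, Term.subst]
      · rfl
      · by_cases hj : j ∈ M <;>
          simp [Subst.comp, substActiveInternal, substActive, Term.subst, Link.subst, hj, allActive]
    · refine F.subst_congr (fun i => i.elim0) ?_
      rintro (j | j | j) hp
      · obtain rfl : j = n := hFn hp
        simp [Subst.comp, substActiveInternal, Link.subst]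
      · rfl
      · by_cases hj : j ∈ M <;>
          simp [Subst.comp, substActiveInternal, Term.subst, Link.subst, hj, allActive]
  -- Linkability: the passive parameters of `D` come from `F`, `Γ`, `Δ`, and they survive in the
  -- sequent of the link because every passive parameter is left fixed.
  · intro α hα
    have hαF : ∀ σ : Subst 0 0, σ.param (.passive α) = .param (.passive α) →
        Param.passive α ∈ F.params → Param.passive α ∈ (F.subst σ).params := fun σ hσ h =>
      Formula.params_subst_of_mem h (by rw [hσ]; rfl)
    refine Sequent.mem_params_subst.2 ⟨.passive α, ?_, rfl⟩
    have hF' : .passive α ∈ F.params ∨ Param.passive α ∈ Sequent.params ⟨Γ, Δ⟩ := by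
      rw [hCD] at hα
      rcases hα with ⟨A, hA, h⟩ | ⟨A, hA, h⟩ <;> rcases Multiset.mem_cons.1 hA with rfl | hA
      · obtain ⟨q, hq, h⟩ := Formula.mem_params_subst_zero h
        rcases q with j | j | j
        · simp only [substActive] at h
          split_ifs at h <;> cases h
        · cases h; exact Or.inl hq
        · cases h
      · exact Or.inr (Or.inl ⟨A, hA, h⟩)
      · exact Or.inl h
      · exact Or.inr (Or.inr ⟨A, hA, h⟩)
    rcases hF' with h | ⟨A, hA, h⟩ | ⟨A, hA, h⟩
    · exact Or.inl ⟨_, Multiset.mem_cons_self _ _, hαF _ rfl h⟩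
    · exact Or.inl ⟨A, Multiset.mem_cons_of_mem hA, h⟩
    · exact Or.inr ⟨A, Multiset.mem_cons_of_mem hA, h⟩

theorem MvLKIE.translatable {S : Sequent} (d : MvLKIE S) : Translatable S := by
  induction d with
  | initial _ h => exact translatable_initial h
  | leaf _ ℓ => exact ℓ.elim
  | unary _ h _ ih => exact .unary h ih
  | binary _ h _ _ ih₁ ih₂ => exact .binary h ih₁ ih₂
  | rule _ h d ih => exact .mvInd h d.atMostOneActive ih

/-! ### Reading a schema off a linked list -/

theorem Linked.symbol_get {E : List Component} (hE : Linked E) (i : Fin E.length) :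
    (E.get i).symbol + i + 1 = E.length := by
  induction hE with
  | nil => exact i.elim0
  | cons hE hs _ _ ih =>
    refine Fin.cases ?_ (fun i => ?_) i
    · simp [hs]
    · have := ih i
      simp at this ⊢
      omega

theorem Linked.link_get {E : List Component} (hE : Linked E) (i : Fin E.length) :
    (∀ T ℓ, ⟨T, ℓ⟩ ∈ (E.get i).base.leaves → ∃ j, i < j ∧ ℓ.symbol = (E.get j).symbol ∧
      T = (E.get j).endSequent.subst ℓ.subst ∧ (E.get j).endSequent.passives ⊆ T.passives) ∧
    (∀ T ℓ, ⟨T, ℓ⟩ ∈ (E.get i).step.leaves → (∃ j, i < j ∧ ℓ.symbol = (E.get j).symbol ∧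
      T = (E.get j).endSequent.subst ℓ.subst ∧ (E.get j).endSequent.passives ⊆ T.passives) ∨
      RecursiveLink (E.get i).symbol (E.get i).n (E.get i).endSequent T ℓ) := by
  induction hE with
  | nil => exact i.elim0
  | @cons C E hE hs hb hst ih =>
    have key : ∀ T ℓ, LinkTo E T ℓ → ∃ j : Fin (C :: E).length, 0 < j ∧
        ℓ.symbol = ((C :: E).get j).symbol ∧ T = ((C :: E).get j).endSequent.subst ℓ.subst ∧
        ((C :: E).get j).endSequent.passives ⊆ T.passives := by
      rintro T ℓ ⟨D, hD, h⟩
      obtain ⟨j, rfl⟩ := List.get_of_mem hD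
      exact ⟨j.succ, Fin.succ_pos j, h⟩
    refine Fin.cases ?_ (fun i => ?_) i
    · exact ⟨fun T ℓ h => key T ℓ (hb T ℓ h), fun T ℓ h => (hst T ℓ h).imp_left (key T ℓ)⟩
    · refine ⟨fun T ℓ h => ?_, fun T ℓ h => ?_⟩
      · obtain ⟨j, hj, h⟩ := (ih i).1 T ℓ h
        exact ⟨j.succ, Fin.succ_lt_succ_iff.2 hj, h⟩
      · refine ((ih i).2 T ℓ h).imp_left ?_
        rintro ⟨j, hj, h⟩
        exact ⟨j.succ, Fin.succ_lt_succ_iff.2 hj, h⟩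

theorem Linked.exists_schema {C : Component} {E : List Component} (h : Linked (C :: E)) :
    ∃ Ψ : PSchema Set.univ, Ψ.endSequent = C.endSequent := by
  -- Each symbol is the length of the tail behind its component, so symbols count down along the
  -- list and determine the position.
  have hinj : Function.Injective fun i : Fin (C :: E).length => ((C :: E).get i).symbol := by
    intro i j hij
    have hi := h.symbol_get i
    have hj := h.symbol_get j
    have hij : ((C :: E).get i).symbol = ((C :: E).get j).symbol := hij
    ext
    omega
  refine ⟨⟨E.length, (C :: E).get, hinj, fun _ => Set.subset_univ _, fun i j => i < j,
    fun _ _ _ => lt_trans, wellFounded_lt, fun i j hij => ⟨fun he => ?_, fun T ℓ hT hs => ?_⟩,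
    fun i hi => Fin.pos_of_ne_zero hi, fun i T ℓ hT => ?_, fun i T ℓ hT => ?_⟩, rfl⟩
  · exact hij.ne (hinj (congrArg Component.symbol he))
  · have key : (∃ k, i < k ∧ ℓ.symbol = ((C :: E).get k).symbol ∧
        T = ((C :: E).get k).endSequent.subst ℓ.subst ∧
        ((C :: E).get k).endSequent.passives ⊆ T.passives) →
        ((C :: E).get j).endSequent.passives ⊆ T.passives := by
      rintro ⟨k, -, hk, -, hp⟩
      obtain rfl : k = j := hinj (hk.symm.trans hs)
      exact hp
    rcases hT with hT | hT
    · exact key ((h.link_get i).1 T ℓ hT)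
    · rcases (h.link_get i).2 T ℓ hT with hT | hT
      · exact key hT
      -- A recursive link carries the symbol of the component `i` itself, so it is no link to `j`.
      · exact (hij.ne (hinj (hT.1.symm.trans hs))).elim
  · obtain ⟨j, hj, h₁, h₂, -⟩ := (h.link_get i).1 T ℓ hT
    exact ⟨j, h₁, h₂, hj⟩
  · rcases (h.link_get i).2 T ℓ hT with ⟨j, hj, h₁, h₂, -⟩ | ⟨h₁, h₂, h₃⟩
    · exact ⟨j, h₁, h₂, Or.inl hj⟩
    · exact ⟨i, h₁, h₂, Or.inr ⟨rfl, h₃⟩⟩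

/-- One further component, without recursive calls, is put in front with end-sequent `S`. Its two
cases are the invariant at `u = 0` and `u = s(n)`. -/
theorem MvLKIE.exists_schema {S : Sequent} (d : MvLKIE S) :
    ∃ Ψ : PSchema Set.univ, Ψ.endSequent = S := by
  obtain ⟨n, hn⟩ : ∃ n, S.actives ⊆ {n} := by
    rcases d.atMostOneActive.eq_empty_or_singleton with h | ⟨n, h⟩
    · exact ⟨0, by simp [h]⟩
    · exact ⟨n, h.le⟩
  obtain ⟨L, hL, hd⟩ := d.translatable [] .nil
  have h₀ := hd .zero (by simp [Term.actives, Term.params]) (by simp [Term.params])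
  have h₁ := hd (.succ (.param (.active n))) (by simp [Term.actives, Term.params])
    (by simp [Term.params])
  rw [Sequent.subst_allActive_eq hn] at h₀ h₁
  rw [show Term.actives .zero = ∅ by simp [Term.actives, Term.params]] at h₀
  rw [show Term.actives (.succ (.param (.active n))) = {n} by
    ext m; simp [Term.actives, Term.params]] at h₁
  obtain ⟨C, rfl, -, hC⟩ := exists_component hL hn h₀ (h₁.imp fun T ℓ h => Or.inl h)
  exact hC.exists_schema

end PSchemata

theorem mainTheorem2 (S : PSchemata.Sequent) :
    (∃ (P : Set ℕ) (Ψ : PSchemata.PSchema P), Ψ.endSequent = S) ↔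
      Nonempty (PSchemata.MvLKIE S) := by
  constructor
  · rintro ⟨P, Ψ, rfl⟩
    exact Ψ.derivable
  · rintro ⟨d⟩
    exact ⟨_, d.exists_schema⟩
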